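/- All Hilbert spaces are finite-dimensional. Let $A,B,A',B'$ be quantum systems, $U$ a unitary from $A\otimes B$ onto $A'\otimes B'$, $\rho_B$ a state on $B$, and $X_A,X_B,X_{A'},X_{B'}$ Hermitian operators on the respective systems. Put $$\mathcal E(\cdot)=\mathrm{Tr}_{B'}[U(\cdot\otimes\rho_B)U^\dagger],\quad Y=X_A-\mathcal E^\dagger(X_{A'}),\quad Z=U^\dagger(X_{A'}\otimes 1+1\otimes X_{B'})U-(X_A\otimes 1+1\otimes X_B),$$ where $\mathcal E^\dagger$ is the dual map, $\mathrm{Tr}[\mathcal E^\dagger(W)\rho]=\mathrm{Tr}[W\mathcal E(\rho)]$. (The conservation law is not assumed; $Z$ measures its violation.) Let $\Delta_Z$ be the difference between the maximal and the minimal eigenvalue of $Z$. For a state $\rho$ and a Hermitian $X$ let $\mathcal F_\rho(X)=\mathrm{Tr}[\rho L^2]$ be the SLD quantum Fisher information of the family $e^{-iXt}\rho e^{iXt}$, where $L$ is any Hermitian solution of $i[\rho,X]=(L\rho+\rho L)/2$. Write $\mathcal F=\mathcal F_{\rho_B}(X_B)$ and, for a state $\rho$ on $A$, $$\Delta_\rho=\sqrt{\mathcal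 F_{\rho\otimes\rho_B}\big(X_A\otimes 1-U^\dagger(X_{A'}\otimes 1)U\big)}.$$ (i) (Operator conversion.) Let $\rho$ be a state on $A$, $Q$ an orthogonal projection on $A$, $0\le P\le 1$ an operator on $A'$, and $\epsilon\ge 0$ with $\mathrm{Tr}[\mathcal E^\dagger(P)(1-Q)\rho(1-Q)]+\mathrm{Tr}[(1-\mathcal E^\dagger(P))Q\rho Q]\le\epsilon^2$. Then $$\big|\mathrm{Tr}(\rho[Q,Y])\big|-\tfrac{\Delta_Z}{2}\le\epsilon\,\big(\Delta_\rho+\Delta_Z+\sqrt{\mathcal F}\big).$$ Now let $\{p_k,\rho_k\}$ be a finite test ensemble: states $\rho_k$ on $A$ with probabilities $p_k\ge0$, $\sum_kp_k=1$. With $F(\rho,\sigma)=\mathrm{Tr}\sqrt{\sqrt\rho\,\sigma\sqrt\rho}$, $D_F=\sqrt{1-F^2}$, $T(\rho,\sigma)=\frac12\|\rho-\sigma\|_1$, and $M_\pm$ the positive and negative parts of a Hermitian $M$, define $$\delta=\inf_{\mathcal R}\sqrt{\sum_kp_kD_F(\rho_k,\mathcal R\circ\mathcal E(\rho_k))^2}\quad(\mathcal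 R\text{ ranging over CPTP maps }A'\to A),$$ $$\mathcal C=\sqrt{\sum_{k\ne k'}p_kp_{k'}\mathrm{Tr}[(\rho_k-\rho_{k'})_+Y(\rho_k-\rho_{k'})_-Y]},\qquad \overline T=\sqrt{\sum_{k,k'}p_kp_{k'}T(\rho_k,\rho_{k'})^2},$$ and let $\Delta$ be the supremum of $\Delta_\sigma$ over the states $\sigma$ on $A$ supported in the subspace spanned by the supports of all $\rho_k$. (ii) (Orthogonal test states.) If $F(\rho_k,\rho_{k'})=0$ for all $k\ne k'$, then $$\mathcal C-\tfrac{\Delta_Z}{2}\le\delta\sqrt{1-\min_kp_k}\;\big(\Delta+\Delta_Z+\sqrt{\mathcal F}\big),\qquad \delta\sqrt{1-\min_kp_k}\le\delta .$$ (iii) (Arbitrary test states.) In general, $$\mathcal C-\tfrac{\Delta_Z}{2}\le\sqrt{\delta}\,\sqrt{\overline T}\;\big(\Delta+\Delta_Z+\sqrt{\mathcal F}\big),\qquad \sqrt{\delta}\,\sqrt{\overline T}\le\sqrt\delta .$$ When $\Delta_\rho+\Delta_Z+\sqrt{\mathcal F}$ (in (i)) or $\Delta+\Delta_Z+\sqrt{\mathcal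 F}$ (in (ii) and (iii)) is positive one may divide by it; the quotient forms are the trade-offs $\frac{\mathcal C}{\Delta+\sqrt{\mathcal F}}\le\dots$ of the conserved case with $\mathcal C$ replaced by $\mathcal C-\Delta_Z/2$ and $\Delta$ by $\Delta+\Delta_Z$. -/

import Mathlib

open scoped Kronecker Matrix ComplexOrder

namespace QuantumTradeoff

noncomputable section

/-! A finite-dimensional quantum system is a finite index type `a` (an orthonormal basis of its
Hilbert space); operators on it are matrices `Matrix a a ℂ`, and the joint system of `a` and `b` is
`a × b`. A unitary identifying / acting between `a × b` and `a' × b'` is a matrix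
`U : Matrix (a' × b') (a × b) ℂ` with `Uᴴ * U = 1` and `U * Uᴴ = 1`. -/

/-- Density operators. -/
def IsState {a : Type*} [Fintype a] (ρ : Matrix a a ℂ) : Prop :=
  ρ.PosSemidef ∧ ρ.trace = 1

/-- Partial trace over the second factor. -/
def partialTrace {a b : Type*} [Fintype b] (M : Matrix (a × b) (a × b) ℂ) : Matrix a a ℂ :=
  Matrix.of fun i j => ∑ k, M (i, k) (j, k)

/-- Completely positive trace-preserving maps. -/
def IsCPTP {a b : Type*} [Fintype a] [Fintype b]
    (Φ : Matrix a a ℂ →ₗ[ℂ] Matrix b b ℂ) : Prop :=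
  (∀ (n : ℕ) (M : Matrix (Fin n × a) (Fin n × a) ℂ), M.PosSemidef →
    (Matrix.of fun (x y : Fin n × b) =>
      Φ (Matrix.of fun i j => M (x.1, i) (y.1, j)) x.2 y.2).PosSemidef) ∧
  ∀ M, (Φ M).trace = M.trace

/-- The map `ρ ↦ Tr_{b'} [U (ρ ⊗ ρB) U†]` implemented by the interaction `U` with an environment
in the state `ρB`. -/
def channel {a b a' b' : Type*} [Fintype a] [Fintype b] [Fintype b']
    (U : Matrix (a' × b') (a × b) ℂ) (ρB : Matrix b b ℂ) :
    Matrix a a ℂ →ₗ[ℂ] Matrix a' a' ℂ where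
  toFun ρ := partialTrace (U * (ρ ⊗ₖ ρB) * Uᴴ)
  map_add' ρ σ := by
    ext i j
    simp [partialTrace, Matrix.add_kronecker, Matrix.mul_add, Matrix.add_mul,
      Finset.sum_add_distrib]
  map_smul' c ρ := by
    ext i j
    simp [partialTrace, Matrix.smul_kronecker, Finset.mul_sum]

/-- The dual map `Φ†`, determined by `Tr[Φ†(W) ρ] = Tr[W Φ(ρ)]`, see `trace_dualMap_mul`. -/
def dualMap {a b : Type*} [DecidableEq a] [Fintype b]
    (Φ : Matrix a a ℂ →ₗ[ℂ] Matrix b b ℂ) (W : Matrix b b ℂ) : Matrix a a ℂ :=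
  Matrix.of fun i j => (W * Φ (Matrix.single j i 1)).trace

theorem trace_dualMap_mul {a b : Type*} [Fintype a] [DecidableEq a] [Fintype b]
    (Φ : Matrix a a ℂ →ₗ[ℂ] Matrix b b ℂ) (W : Matrix b b ℂ) (ρ : Matrix a a ℂ) :
    (dualMap Φ W * ρ).trace = (W * Φ ρ).trace := by
  have h : Φ ρ = ∑ i, ∑ j, ρ i j • Φ (Matrix.single i j 1) := by
    conv_lhs => rw [Matrix.matrix_eq_sum_single ρ]
    rw [map_sum]
    refine Finset.sum_congr rfl fun i _ => ?_
    rw [map_sum]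
    refine Finset.sum_congr rfl fun j _ => ?_
    rw [← map_smul]
    simp
  rw [h]
  simp only [Matrix.mul_sum, Matrix.trace_sum, Matrix.mul_smul, Matrix.trace_smul, smul_eq_mul]
  rw [Finset.sum_comm]
  simp only [Matrix.trace, Matrix.diag, Matrix.mul_apply, dualMap, Matrix.of_apply]
  refine Finset.sum_congr rfl fun i _ => Finset.sum_congr rfl fun j _ => ?_
  rw [mul_comm]

/-- The absolute value `|M|` of a Hermitian matrix, by functional calculus. -/
def absPart {a : Type*} [Fintype a] [DecidableEq a] (M : Matrix a a ℂ) : Matrix a a ℂ :=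
  cfc (fun x : ℝ => |x|) M

/-- The positive part `M₊`, by functional calculus. -/
def positivePart {a : Type*} [Fintype a] [DecidableEq a] (M : Matrix a a ℂ) : Matrix a a ℂ :=
  cfc (fun x : ℝ => max x 0) M

/-- The negative part `M₋` (so `M = M₊ - M₋`), by functional calculus. -/
def negativePart {a : Type*} [Fintype a] [DecidableEq a] (M : Matrix a a ℂ) : Matrix a a ℂ :=
  cfc (fun x : ℝ => max (-x) 0) M

/-- The square root `√M` of a positive semidefinite matrix, by functional calculus. -/
def sqrtMat {a : Type*} [Fintype a] [DecidableEq a] (M : Matrix a a ℂ) : Matrix a a ℂ :=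
  cfc Real.sqrt M

/-- The (root) fidelity `F(ρ, σ) = Tr √(√ρ σ √ρ)`. -/
def fidelity {a : Type*} [Fintype a] [DecidableEq a] (ρ σ : Matrix a a ℂ) : ℝ :=
  (sqrtMat (sqrtMat ρ * σ * sqrtMat ρ)).trace.re

/-- The purified distance. -/
def purifiedDist {a : Type*} [Fintype a] [DecidableEq a] (ρ σ : Matrix a a ℂ) : ℝ :=
  √(1 - fidelity ρ σ ^ 2)

/-- The trace distance `‖ρ - σ‖₁ / 2` of Hermitian matrices. -/
def traceDist {a : Type*} [Fintype a] [DecidableEq a] (ρ σ : Matrix a a ℂ) : ℝ :=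
  (absPart (ρ - σ)).trace.re / 2

/-- Difference between the maximal and the minimal eigenvalue of a Hermitian matrix. -/
def spread {a : Type*} [Fintype a] [DecidableEq a] (W : Matrix a a ℂ) : ℝ :=
  sSup (spectrum ℝ W) - sInf (spectrum ℝ W)

/-- `L` is a symmetric logarithmic derivative at `t = 0` of the family `e^{-iXt} ρ e^{iXt}`:
`i[ρ, X] = (L ρ + ρ L) / 2`. -/
def IsSLD {a : Type*} [Fintype a] (ρ X L : Matrix a a ℂ) : Prop :=
  L.IsHermitian ∧ Complex.I • (ρ * X - X * ρ) = (2⁻¹ : ℂ) • (L * ρ + ρ * L)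

/-- The SLD quantum Fisher information `Tr[ρ L²]` of the family `e^{-iXt} ρ e^{iXt}`. A symmetric
logarithmic derivative `L` exists (`exists_isSLD`) and the value does not depend on its choice
(`qfi_eq`). -/
def qfi {a : Type*} [Fintype a] (ρ X : Matrix a a ℂ) : ℝ :=
  sInf {f : ℝ | ∃ L, IsSLD ρ X L ∧ f = (ρ * (L * L)).trace.re}

theorem exists_isSLD {a : Type*} [Fintype a] [DecidableEq a] {ρ X : Matrix a a ℂ}
    (hρ : ρ.PosSemidef) (hX : X.IsHermitian) : ∃ L, IsSLD ρ X L := by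
  obtain ⟨V, D, hD, hVV, hVV', hρV⟩ : ∃ (V : Matrix a a ℂ) (D : a → ℝ), (∀ i, 0 ≤ D i) ∧
      Vᴴ * V = 1 ∧ V * Vᴴ = 1 ∧ ρ = V * Matrix.diagonal (fun i => (D i : ℂ)) * Vᴴ := by
    refine ⟨hρ.1.eigenvectorUnitary, hρ.1.eigenvalues, hρ.eigenvalues_nonneg,
      Unitary.coe_star_mul_self hρ.1.eigenvectorUnitary,
      Unitary.coe_mul_star_self hρ.1.eigenvectorUnitary, ?_⟩
    exact hρ.1.spectral_theorem
  set M : Matrix a a ℂ := Vᴴ * X * V with hM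
  have hMh : Mᴴ = M := by
    simp [hM, Matrix.conjTranspose_mul, hX.eq, Matrix.mul_assoc]
  have hXM : X = V * M * Vᴴ := by
    calc X = (V * Vᴴ) * X * (V * Vᴴ) := by simp [hVV']
      _ = V * M * Vᴴ := by simp only [hM, Matrix.mul_assoc]
  set G : Matrix a a ℂ := Matrix.diagonal (fun i => (D i : ℂ)) with hG
  let K : Matrix a a ℂ := Matrix.of fun i j =>
    2 * Complex.I * ((D i : ℂ) - D j) / ((D i : ℂ) + D j) * M i j
  have hK : Kᴴ = K := by
    ext i j
    have h1 : star (M j i) = M i j := by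
      conv_rhs => rw [← hMh]
      rfl
    simp only [K, Matrix.conjTranspose_apply, Matrix.of_apply, star_mul', star_div₀, star_add,
      star_sub, h1, Complex.star_def, Complex.conj_ofReal, Complex.conj_I, map_ofNat]
    rw [add_comm (D j : ℂ)]
    ring
  have hmain : Complex.I • (G * M - M * G) = (2⁻¹ : ℂ) • (K * G + G * K) := by
    ext i j
    simp only [hG, K, Matrix.smul_apply, Matrix.sub_apply, Matrix.add_apply,
      Matrix.diagonal_mul, Matrix.mul_diagonal, Matrix.of_apply, smul_eq_mul]
    by_cases h : (D i : ℂ) + D j = 0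
    · have h' : D i + D j = 0 := by exact_mod_cast h
      have hi : D i = 0 := by linarith [hD i, hD j]
      have hj : D j = 0 := by linarith [hD i, hD j]
      simp [hi, hj]
    · field_simp
      ring
  have hconj : ∀ S T : Matrix a a ℂ, (V * S * Vᴴ) * (V * T * Vᴴ) = V * (S * T) * Vᴴ := by
    intro S T
    calc (V * S * Vᴴ) * (V * T * Vᴴ) = V * S * (Vᴴ * V) * T * Vᴴ := by
          simp only [Matrix.mul_assoc]
      _ = V * (S * T) * Vᴴ := by simp [hVV, Matrix.mul_assoc]
  refine ⟨V * K * Vᴴ, ?_, ?_⟩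
  · simp [Matrix.IsHermitian, Matrix.conjTranspose_mul, hK, Matrix.mul_assoc]
  · rw [hXM, hρV, hconj, hconj, hconj, hconj, ← Matrix.sub_mul, ← Matrix.mul_sub,
      ← Matrix.add_mul, ← Matrix.mul_add, ← Matrix.smul_mul, ← Matrix.mul_smul, hmain,
      ← Matrix.smul_mul, ← Matrix.mul_smul]

theorem qfi_eq {a : Type*} [Fintype a] {ρ X L : Matrix a a ℂ} (hL : IsSLD ρ X L) :
    qfi ρ X = (ρ * (L * L)).trace.re := by
  have key : ∀ L', IsSLD ρ X L' → (ρ * (L' * L')).trace = (ρ * (L * L)).trace := by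
    intro L' hL'
    have h : L' * ρ + ρ * L' = L * ρ + ρ * L := by
      have h2 := hL'.2.symm.trans hL.2
      exact smul_right_injective _ (by norm_num : (2⁻¹ : ℂ) ≠ 0) h2
    have e : ∀ S T : Matrix a a ℂ, (S * (T * ρ + ρ * T)).trace
        = (ρ * (S * T)).trace + (ρ * (T * S)).trace := by
      intro S T
      rw [Matrix.mul_add, Matrix.trace_add, ← Matrix.mul_assoc, Matrix.trace_mul_comm,
        ← Matrix.mul_assoc S ρ T, Matrix.trace_mul_comm (S * ρ) T, ← Matrix.mul_assoc T S ρ,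
        Matrix.trace_mul_comm (T * S) ρ]
    have e1 := e L' L'
    have e2 := e L L
    have e3 := e L' L
    have e4 := e L L'
    rw [h] at e1 e4
    have h5 : 2 * (ρ * (L' * L')).trace = 2 * (ρ * (L * L)).trace := by
      linear_combination e3 - e1 + e2 - e4
    exact mul_left_cancel₀ two_ne_zero h5
  have hset : {f : ℝ | ∃ L', IsSLD ρ X L' ∧ f = (ρ * (L' * L')).trace.re}
      = {(ρ * (L * L)).trace.re} := by
    ext f
    constructor
    · rintro ⟨L', hL', rfl⟩
      rw [key L' hL']
      rfl
    · rintro rfl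
      exact ⟨L, hL, rfl⟩
  rw [qfi, hset, csInf_singleton]

/-- The operator `Y = X_A - Φ†(X_{A'})`, the local change of the quantity under `Φ`. -/
def changeOp {a a' : Type*} [DecidableEq a] [Fintype a']
    (Φ : Matrix a a ℂ →ₗ[ℂ] Matrix a' a' ℂ) (XA : Matrix a a ℂ) (XA' : Matrix a' a' ℂ) :
    Matrix a a ℂ :=
  XA - dualMap Φ XA'

/-- The violation `Z = U†(X_{A'} + X_{B'})U - (X_A + X_B)` of the conservation law. -/
def violation {a b a' b' : Type*} [DecidableEq a] [DecidableEq b]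
    [Fintype a'] [DecidableEq a'] [Fintype b'] [DecidableEq b']
    (U : Matrix (a' × b') (a × b) ℂ) (XA : Matrix a a ℂ) (XB : Matrix b b ℂ)
    (XA' : Matrix a' a' ℂ) (XB' : Matrix b' b' ℂ) : Matrix (a × b) (a × b) ℂ :=
  Uᴴ * (XA' ⊗ₖ (1 : Matrix b' b' ℂ) + (1 : Matrix a' a' ℂ) ⊗ₖ XB') * U
    - (XA ⊗ₖ (1 : Matrix b b ℂ) + (1 : Matrix a a ℂ) ⊗ₖ XB)

/-- `√F_{ρ ⊗ ρB}(X_A ⊗ 1 - U† (X_{A'} ⊗ 1) U)`. -/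
def stateDelta {a b a' b' : Type*} [Fintype a] [Fintype b] [DecidableEq b]
    [Fintype a'] [Fintype b'] [DecidableEq b']
    (U : Matrix (a' × b') (a × b) ℂ) (ρB : Matrix b b ℂ) (XA : Matrix a a ℂ)
    (XA' : Matrix a' a' ℂ) (ρ : Matrix a a ℂ) : ℝ :=
  √(qfi (ρ ⊗ₖ ρB)
    (XA ⊗ₖ (1 : Matrix b b ℂ) - Uᴴ * (XA' ⊗ₖ (1 : Matrix b' b' ℂ)) * U))

/-- `Δ`: the maximum of `stateDelta` over the states supported in the subspace spanned by the
supports of the test states. -/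
def ensembleDelta {a b a' b' κ : Type*} [Fintype a] [Fintype b] [DecidableEq b]
    [Fintype a'] [Fintype b'] [DecidableEq b']
    (U : Matrix (a' × b') (a × b) ℂ) (ρB : Matrix b b ℂ) (XA : Matrix a a ℂ)
    (XA' : Matrix a' a' ℂ) (ρ : κ → Matrix a a ℂ) : ℝ :=
  sSup {d : ℝ | ∃ σ : Matrix a a ℂ, IsState σ ∧
    LinearMap.range σ.mulVecLin ≤ ⨆ k, LinearMap.range (ρ k).mulVecLin ∧
    d = stateDelta U ρB XA XA' σ}

/-- `C`: the off-diagonal strength of `Y` for the test ensemble `{p k, ρ k}`. -/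
def offDiag {a κ : Type*} [Fintype a] [DecidableEq a] [Fintype κ] [DecidableEq κ]
    (p : κ → ℝ) (ρ : κ → Matrix a a ℂ) (Y : Matrix a a ℂ) : ℝ :=
  √(∑ k, ∑ k' ∈ Finset.univ.filter (fun k' => k' ≠ k), p k * p k' *
    (positivePart (ρ k - ρ k') * Y * negativePart (ρ k - ρ k') * Y).trace.re)

/-- Root mean square recovery error of a fixed recovery map `R`. -/
def recoveryError {a a' κ : Type*} [Fintype a] [DecidableEq a] [Fintype κ]
    (Φ : Matrix a a ℂ →ₗ[ℂ] Matrix a' a' ℂ) (p : κ → ℝ) (ρ : κ → Matrix a a ℂ)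
    (R : Matrix a' a' ℂ →ₗ[ℂ] Matrix a a ℂ) : ℝ :=
  √(∑ k, p k * purifiedDist (ρ k) (R (Φ (ρ k))) ^ 2)

/-- `δ`: the irreversibility of `Φ` for the test ensemble, i.e. the recovery error optimized over
all CPTP recovery maps. -/
def irreversibility {a a' κ : Type*} [Fintype a] [DecidableEq a] [Fintype a'] [Fintype κ]
    (Φ : Matrix a a ℂ →ₗ[ℂ] Matrix a' a' ℂ) (p : κ → ℝ) (ρ : κ → Matrix a a ℂ) : ℝ :=
  sInf {e : ℝ | ∃ R : Matrix a' a' ℂ →ₗ[ℂ] Matrix a a ℂ, IsCPTP R ∧ e = recoveryError Φ p ρ R}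

/-- The root mean square pairwise trace distance of the test ensemble. -/
def meanTraceDist {a κ : Type*} [Fintype a] [DecidableEq a] [Fintype κ]
    (p : κ → ℝ) (ρ : κ → Matrix a a ℂ) : ℝ :=
  √(∑ k, ∑ k', p k * p k' * traceDist (ρ k) (ρ k') ^ 2)

end

end QuantumTradeoff

open QuantumTradeoff

namespace QuantumTradeoff

open scoped MatrixOrder

set_option linter.unusedSectionVars false

noncomputable section

/-! ### Positivity, functional calculus and ranges of matrices. -/

section MatrixFacts

variable {a : Type*} [Fintype a] [DecidableEq a]

/-! Operator conversion. On the joint system put τ = ρ ⊗ ρ_B, q = Q ⊗ 1, p = U†(P ⊗ 1)U and N = X_A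
⊗ 1 - U†(X_{A'} ⊗ 1)U. Then Tr(ρ[Q,Y]) = Tr(τ[q,N]), and the definition of Z reads N = V - X - Z
with V = U†(1 ⊗ X_{B'})U and X = 1 ⊗ X_B. Since p commutes with V and q commutes with X, the
difference D = q - p satisfies [q,N] = [D,N] + [D,Z] + [D,X] - [q,Z]. The error condition says that
p is close to q: Tr(D²τ) ≤ ε², because p² ≤ p. Writing commutators with τ through an SLD and
applying Cauchy–Schwarz bounds the [D,N] and [D,X] terms by ε times a root of a Fisher information
(`norm_trace_commutator_le_qfi`). Centring Z bounds the [D,Z] term by ε Δ_Z and the [q,Z] term by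
Δ_Z √(w(1-w)) with w = Tr(Qρ), which is at most Δ_Z/2. This is `operator_conversion`.

Ensembles. A recovery map R pulls a test Q on A back to the effect P = R†(Q) on A'. The error
condition sees only the diagonal blocks α = QσQ and β = (1-Q)σ(1-Q), so the off-diagonal blocks of σ
may be chosen freely; `exists_coherent_state` chooses them so that |Tr(σ[Q,Y])| = 2√Tr(αYβY). Hence
every discrimination task for orthogonal α, β bounds one such trace (`discrimination_tradeoff`).

For orthogonal states, each ρ_k is tested against all the others together; missed and false
detections each sum to at most δ², since a test that is certain on ρ_k fails on the recovered state
with probability at most D_F² (`one_sub_re_trace_support_le`). For arbitrary states, each pair is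
tested with the Helstrom projection on the normalised parts of ρ_k - ρ_k'. There the error is only
linear in D_F, so √δ replaces δ. Minkowski's inequality combines the individual bounds, and an
infimum over R finishes. -/

theorem exists_eq_conjTranspose_mul_self {τ : Matrix a a ℂ} (hτ : τ.PosSemidef) :
    ∃ S : Matrix a a ℂ, τ = Sᴴ * S :=
  CStarAlgebra.nonneg_iff_eq_star_mul_self.mp (Matrix.nonneg_iff_posSemidef.mpr hτ)

theorem re_trace_nonneg {τ : Matrix a a ℂ} (hτ : τ.PosSemidef) : 0 ≤ τ.trace.re :=
  (Complex.le_def.mp hτ.trace_nonneg).1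

theorem trace_eq_re {τ : Matrix a a ℂ} (hτ : τ.PosSemidef) : τ.trace = (τ.trace.re : ℂ) :=
  Complex.ext rfl (by simpa using (Complex.le_def.mp hτ.trace_nonneg).2.symm)

theorem re_trace_mul_nonneg {A τ : Matrix a a ℂ} (hA : A.PosSemidef) (hτ : τ.PosSemidef) :
    0 ≤ (A * τ).trace.re := by
  obtain ⟨S, rfl⟩ := exists_eq_conjTranspose_mul_self hτ
  rw [← Matrix.mul_assoc, Matrix.trace_mul_comm, ← Matrix.mul_assoc]
  exact re_trace_nonneg (hA.mul_mul_conjTranspose_same S)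

theorem re_trace_mul_le {A B τ : Matrix a a ℂ} (h : (B - A).PosSemidef) (hτ : τ.PosSemidef) :
    (A * τ).trace.re ≤ (B * τ).trace.re := by
  have := re_trace_mul_nonneg h hτ
  rw [Matrix.sub_mul, Matrix.trace_sub, Complex.sub_re] at this
  linarith

/-- The Cauchy–Schwarz inequality for the positive functional `M ↦ Tr(M τ)`. -/
theorem norm_trace_mul_le {τ : Matrix a a ℂ} (hτ : τ.PosSemidef) (A B : Matrix a a ℂ) :
    ‖(Aᴴ * B * τ).trace‖ ≤ √(Aᴴ * A * τ).trace.re * √(Bᴴ * B * τ).trace.re := by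
  let : SeminormedAddCommGroup (Matrix a a ℂ) := τ.toMatrixSeminormedAddCommGroup hτ
  let : InnerProductSpace ℂ (Matrix a a ℂ) := τ.toMatrixInnerProductSpace hτ
  have hin : ∀ A B : Matrix a a ℂ, inner ℂ A B = (Aᴴ * B * τ).trace := fun A B => by
    rw [Matrix.mul_assoc, Matrix.trace_mul_comm]; rfl
  have hn : ∀ A : Matrix a a ℂ, ‖A‖ = √(Aᴴ * A * τ).trace.re := fun A => by
    rw [← hin, norm_eq_sqrt_re_inner (𝕜 := ℂ)]; rfl
  rw [← hin, ← hn, ← hn]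
  exact norm_inner_le_norm A B

theorem norm_trace_conjTranspose_mul_le (A B : Matrix a a ℂ) :
    ‖(Aᴴ * B).trace‖ ≤ √(Aᴴ * A).trace.re * √(Bᴴ * B).trace.re := by
  simpa using norm_trace_mul_le Matrix.PosSemidef.one A B

/-- Rank-one τ already suffice, since their traces against M are its quadratic form. This is how
effects are recognised after a dual map known only through traces. -/
theorem posSemidef_of_trace_mul_nonneg {M : Matrix a a ℂ}
    (h : ∀ τ : Matrix a a ℂ, τ.PosSemidef → 0 ≤ (M * τ).trace) : M.PosSemidef := by
  rw [← Matrix.nonneg_iff_posSemidef]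
  have key : ∀ x : a → ℂ, 0 ≤ star x ⬝ᵥ M.mulVec x := fun x => by
    have := h _ (Matrix.posSemidef_vecMulVec_self_star x)
    rwa [Matrix.mul_vecMulVec, Matrix.trace_vecMulVec, dotProduct_comm] at this
  rw [Matrix.nonneg_iff_posSemidef, ← Matrix.isPositive_toEuclideanLin_iff,
    LinearMap.isPositive_iff_complex]
  intro x
  have h2 := key x.ofLp
  have h3 : inner ℂ (M.toEuclideanLin x) x = star (star x.ofLp ⬝ᵥ M.mulVec x.ofLp) := by
    rw [← inner_conj_symm, EuclideanSpace.inner_eq_star_dotProduct]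
    simp [Matrix.toLpLin_apply, dotProduct_comm]
  rw [h3]
  obtain ⟨h4, h5⟩ := Complex.le_def.mp h2
  refine ⟨Complex.ext (by simp) (by simpa using h5.symm), by simpa using h4⟩

theorem posSemidef_cfc {f : ℝ → ℝ} (hf : ∀ x, 0 ≤ f x) (M : Matrix a a ℂ) :
    (cfc f M).PosSemidef :=
  Matrix.nonneg_iff_posSemidef.mp (cfc_nonneg fun x _ => hf x)

theorem cfc_mul_cfc (f g : ℝ → ℝ) (M : Matrix a a ℂ) :
    cfc f M * cfc g M = cfc (fun x => f x * g x) M := by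
  have hf : (spectrum ℝ M).Finite := Matrix.finite_real_spectrum
  exact (cfc_mul f g M (hf.continuousOn _) (hf.continuousOn _)).symm

theorem sqrtMat_posSemidef (M : Matrix a a ℂ) : (sqrtMat M).PosSemidef :=
  posSemidef_cfc Real.sqrt_nonneg M

theorem sqrtMat_mul_self {M : Matrix a a ℂ} (hM : M.PosSemidef) : sqrtMat M * sqrtMat M = M := by
  have h := cfc_mul_cfc Real.sqrt Real.sqrt M
  rw [sqrtMat, h]
  conv_rhs => rw [← cfc_id ℝ M hM.isHermitian]
  refine cfc_congr fun x hx => ?_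
  exact Real.mul_self_sqrt (spectrum_nonneg_of_nonneg (Matrix.nonneg_iff_posSemidef.mpr hM) hx)

theorem eq_zero_of_conjTranspose_mul_self {M : Matrix a a ℂ} (h : Mᴴ * M = 0) : M = 0 :=
  Matrix.conjTranspose_mul_self_eq_zero.mp h

theorem sqrtMat_mul_eq_zero {M N : Matrix a a ℂ} (hM : M.PosSemidef) (h : M * N = 0) :
    sqrtMat M * N = 0 := by
  refine eq_zero_of_conjTranspose_mul_self ?_
  rw [Matrix.conjTranspose_mul, (sqrtMat_posSemidef M).isHermitian.eq, Matrix.mul_assoc,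
    ← Matrix.mul_assoc (sqrtMat M), sqrtMat_mul_self hM, h, Matrix.mul_zero]

/-- The support projection of a Hermitian matrix. -/
theorem exists_support_projection {M : Matrix a a ℂ} (hM : M.IsHermitian) :
    ∃ Q : Matrix a a ℂ, Q.IsHermitian ∧ Q * Q = Q ∧ Q * M = M ∧
      ∀ N : Matrix a a ℂ, M * N = 0 → Q * N = 0 := by
  have hid : cfc (fun x : ℝ => x) M = M := cfc_id' ℝ M hM
  -- As 0⁻¹ = 0, the function x⁻¹ * x is the indicator of x ≠ 0, and it factors through M on the
  -- right, which gives the last property.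
  refine ⟨cfc (fun x : ℝ => x⁻¹ * x) M, (cfc_predicate (fun x : ℝ => x⁻¹ * x) M), ?_, ?_, ?_⟩
  · rw [cfc_mul_cfc]
    refine cfc_congr fun x _ => ?_
    by_cases hx : x = 0 <;> simp [hx]
  · conv_lhs => enter [2]; rw [← hid]
    conv_rhs => rw [← hid]
    rw [cfc_mul_cfc]
    refine cfc_congr fun x _ => ?_
    by_cases hx : x = 0 <;> simp [hx]
  · intro N hN
    rw [← cfc_mul_cfc, hid, Matrix.mul_assoc, hN, Matrix.mul_zero]

theorem posSemidef_of_projection {Q : Matrix a a ℂ} (hQ : Q.IsHermitian) (hQQ : Q * Q = Q) :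
    Q.PosSemidef := by
  have := Matrix.posSemidef_conjTranspose_mul_self Q
  rwa [hQ.eq, hQQ] at this

theorem projection_one_sub {Q : Matrix a a ℂ} (hQ : Q.IsHermitian) (hQQ : Q * Q = Q) :
    (1 - Q).IsHermitian ∧ (1 - Q) * (1 - Q) = 1 - Q := by
  refine ⟨Matrix.isHermitian_one.sub hQ, ?_⟩
  simp [Matrix.mul_sub, Matrix.sub_mul, hQQ]

theorem positivePart_posSemidef (M : Matrix a a ℂ) : (positivePart M).PosSemidef :=
  posSemidef_cfc (fun _ => le_max_right _ _) M

theorem negativePart_posSemidef (M : Matrix a a ℂ) : (negativePart M).PosSemidef :=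
  posSemidef_cfc (fun _ => le_max_right _ _) M

theorem positivePart_mul_negativePart (M : Matrix a a ℂ) :
    positivePart M * negativePart M = 0 := by
  rw [positivePart, negativePart, cfc_mul_cfc, ← cfc_zero ℝ M]
  refine cfc_congr fun x _ => ?_
  rcases le_total x 0 with h | h <;> simp [h]

theorem positivePart_sub_negativePart {M : Matrix a a ℂ} (hM : M.IsHermitian) :
    positivePart M - negativePart M = M := by
  have hf : (spectrum ℝ M).Finite := Matrix.finite_real_spectrum
  rw [positivePart, negativePart, ← cfc_sub _ _ M (hf.continuousOn _) (hf.continuousOn _)]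
  conv_rhs => rw [← cfc_id' ℝ M hM]
  refine cfc_congr fun x _ => ?_
  rcases le_total x 0 with h | h <;> simp [h]

theorem positivePart_add_negativePart (M : Matrix a a ℂ) :
    positivePart M + negativePart M = absPart M := by
  have hf : (spectrum ℝ M).Finite := Matrix.finite_real_spectrum
  rw [positivePart, negativePart, absPart,
    ← cfc_add M _ _ (hf.continuousOn _) (hf.continuousOn _)]
  refine cfc_congr fun x _ => ?_
  rcases le_total x 0 with h | h <;> simp [h, abs_of_nonneg, abs_of_nonpos]

/-- Uniqueness of the Jordan decomposition. For orthogonal test states it identifies the parts of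
ρ_k - ρ_k' with the states themselves. -/
theorem posParts_unique {B C : Matrix a a ℂ} (hB : B.PosSemidef) (hC : C.PosSemidef)
    (hBC : B * C = 0) : positivePart (B - C) = B ∧ negativePart (B - C) = C := by
  have h := CFC.posPart_negPart_unique (a := B - C) (b := B) (c := C) rfl hBC
    (Matrix.nonneg_iff_posSemidef.mpr hB) (Matrix.nonneg_iff_posSemidef.mpr hC)
  rw [CFC.posPart_def, CFC.negPart_def] at h
  rw [cfcₙ_eq_cfc, cfcₙ_eq_cfc] at h
  exact h

theorem range_mulVecLin_mul_le {b c : Type*} [Fintype b] [Fintype c]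
    (M : Matrix a b ℂ) (N : Matrix b c ℂ) :
    LinearMap.range (M * N).mulVecLin ≤ LinearMap.range M.mulVecLin := by
  rw [Matrix.mulVecLin_mul]
  exact LinearMap.range_comp_le_range _ _

theorem range_mulVecLin_add_le {b : Type*} [Fintype b] (M N : Matrix a b ℂ) :
    LinearMap.range (M + N).mulVecLin
      ≤ LinearMap.range M.mulVecLin ⊔ LinearMap.range N.mulVecLin := by
  rw [Matrix.mulVecLin_add]
  rintro _ ⟨x, rfl⟩
  exact Submodule.add_mem_sup ⟨x, rfl⟩ ⟨x, rfl⟩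

/-- A function vanishing at 0 factors as x · (x⁻¹ f(x)), so its calculus has M as a left factor. It
keeps the coherent states inside the span of the supports over which Δ is taken. -/
theorem range_sqrtMat_le {M : Matrix a a ℂ} (hM : M.PosSemidef) :
    LinearMap.range (sqrtMat M).mulVecLin ≤ LinearMap.range M.mulVecLin := by
  have hid : cfc (fun x : ℝ => x) M = M := cfc_id' ℝ M hM.isHermitian
  have : sqrtMat M = M * cfc (fun x : ℝ => x⁻¹ * √x) M := by
    conv_rhs => enter [1]; rw [← hid]
    rw [cfc_mul_cfc]
    refine cfc_congr fun x _ => ?_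
    by_cases hx : x = 0 <;> simp [hx]
  rw [this]
  exact range_mulVecLin_mul_le _ _

theorem range_posParts_le {M : Matrix a a ℂ} (hM : M.IsHermitian) :
    LinearMap.range (positivePart M).mulVecLin ≤ LinearMap.range M.mulVecLin ∧
    LinearMap.range (negativePart M).mulVecLin ≤ LinearMap.range M.mulVecLin := by
  have hid : cfc (fun x : ℝ => x) M = M := cfc_id' ℝ M hM
  have key : ∀ f : ℝ → ℝ, f 0 = 0 →
      LinearMap.range (cfc f M).mulVecLin ≤ LinearMap.range M.mulVecLin := by
    intro f hf
    have : cfc f M = M * cfc (fun x : ℝ => x⁻¹ * f x) M := by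
      conv_rhs => enter [1]; rw [← hid]
      rw [cfc_mul_cfc]
      refine cfc_congr fun x _ => ?_
      by_cases hx : x = 0 <;> simp [hx, hf]
    rw [this]
    exact range_mulVecLin_mul_le _ _
  exact ⟨key _ (by simp), key _ (by simp)⟩

/-- Centring a Hermitian matrix makes its square at most the square of half its spread. -/
theorem exists_centre {Z : Matrix a a ℂ} (hZ : Z.IsHermitian) :
    ∃ c : ℝ, (((spread Z / 2) ^ 2 : ℝ) • (1 : Matrix a a ℂ)
      - (Z - c • (1 : Matrix a a ℂ)) * (Z - c • (1 : Matrix a a ℂ))).PosSemidef := by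
  have hf : (spectrum ℝ Z).Finite := Matrix.finite_real_spectrum
  -- The midpoint of the spectrum, from which every eigenvalue has distance at most half the spread.
  set c := (sSup (spectrum ℝ Z) + sInf (spectrum ℝ Z)) / 2 with hc
  refine ⟨c, ?_⟩
  have hid : cfc (fun x : ℝ => x) Z = Z := cfc_id' ℝ Z hZ
  have hconst : ∀ r : ℝ, cfc (fun _ : ℝ => r) Z = r • (1 : Matrix a a ℂ) := fun r =>
    (cfc_const r Z hZ).trans (Algebra.algebraMap_eq_smul_one r)
  have e1 : Z - c • (1 : Matrix a a ℂ) = cfc (fun x : ℝ => x - c) Z := by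
    rw [cfc_sub _ _ Z (hf.continuousOn _) (hf.continuousOn _), hid, hconst]
  have e2 : ((spread Z / 2) ^ 2 : ℝ) • (1 : Matrix a a ℂ)
      = cfc (fun _ : ℝ => (spread Z / 2) ^ 2) Z := by
    rw [hconst]
  rw [e1, e2, cfc_mul_cfc, ← cfc_sub _ _ Z (hf.continuousOn _) (hf.continuousOn _)]
  refine Matrix.nonneg_iff_posSemidef.mp (cfc_nonneg fun x hx => ?_)
  have h1 := le_csSup hf.bddAbove hx
  have h2 := csInf_le hf.bddBelow hx
  rw [spread]
  nlinarith

theorem spread_nonneg (Z : Matrix a a ℂ) : 0 ≤ spread Z := by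
  have hf : (spectrum ℝ Z).Finite := Matrix.finite_real_spectrum
  exact sub_nonneg.mpr (Real.sInf_le_sSup _ hf.bddBelow hf.bddAbove)

end MatrixFacts

/-! ### Commutator bounds by Fisher information and by spread. -/

section FisherInformation

variable {a b : Type*} [Fintype a] [DecidableEq a] [Fintype b] [DecidableEq b]

theorem qfi_nonneg {τ : Matrix a a ℂ} (hτ : τ.PosSemidef) {N : Matrix a a ℂ}
    (hN : N.IsHermitian) : 0 ≤ qfi τ N := by
  obtain ⟨L, hL⟩ := exists_isSLD hτ hN
  rw [qfi_eq hL, Matrix.trace_mul_comm]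
  have := Matrix.posSemidef_conjTranspose_mul_self L
  rw [hL.1.eq] at this
  exact re_trace_mul_nonneg this hτ

theorem IsSLD.commutator_eq {τ N L : Matrix a a ℂ} (hL : IsSLD τ N L) :
    N * τ - τ * N = (Complex.I / 2) • (L * τ + τ * L) := by
  have h := congrArg (fun M => Complex.I • M) hL.2
  simp only [smul_smul, Complex.I_mul_I] at h
  rw [div_eq_mul_inv, ← h]
  simp

theorem norm_trace_mul_le_of_isHermitian {τ : Matrix a a ℂ} (hτ : τ.PosSemidef)
    {A B : Matrix a a ℂ} (hA : A.IsHermitian) (hB : B.IsHermitian) :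
    ‖(A * B * τ).trace‖ ≤ √(A * A * τ).trace.re * √(B * B * τ).trace.re := by
  have := norm_trace_mul_le hτ A B
  rwa [hA.eq, hB.eq] at this

/-- Cyclicity moves the commutator onto the state, Tr([D,N]τ) = Tr(D[N,τ]), and the SLD turns [N,τ]
into (i/2)(Lτ + τL). Each of the two resulting terms is at most √Tr(D²τ) √Tr(L²τ) by Cauchy–Schwarz.
-/
theorem norm_trace_commutator_le_qfi {τ : Matrix a a ℂ} (hτ : τ.PosSemidef)
    {D N : Matrix a a ℂ} (hD : D.IsHermitian) (hN : N.IsHermitian) :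
    ‖((D * N - N * D) * τ).trace‖ ≤ √(D * D * τ).trace.re * √(qfi τ N) := by
  obtain ⟨L, hL⟩ := exists_isSLD hτ hN
  have e : ((D * N - N * D) * τ).trace
      = Complex.I / 2 * ((D * L * τ).trace + (L * D * τ).trace) := by
    have h1 : ((D * N - N * D) * τ).trace = (D * (N * τ - τ * N)).trace := by
      rw [Matrix.sub_mul, Matrix.mul_sub, Matrix.trace_sub, Matrix.trace_sub, Matrix.mul_assoc,
        Matrix.mul_assoc N, Matrix.trace_mul_comm N, Matrix.mul_assoc D τ N]
    rw [h1, hL.commutator_eq, Matrix.mul_smul, Matrix.trace_smul, Matrix.mul_add,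
      Matrix.trace_add, smul_eq_mul, Matrix.mul_assoc, Matrix.mul_assoc L,
      Matrix.trace_mul_comm L, Matrix.mul_assoc D τ L]
  have e2 : qfi τ N = (L * L * τ).trace.re := by rw [qfi_eq hL, Matrix.trace_mul_comm]
  have h1 := norm_trace_mul_le_of_isHermitian hτ hD hL.1
  have h2 := norm_trace_mul_le_of_isHermitian hτ hL.1 hD
  rw [e, e2, norm_mul]
  have h3 := norm_add_le (D * L * τ).trace (L * D * τ).trace
  have h4 : ‖Complex.I / 2‖ = 1 / 2 := by simp
  rw [h4]
  linarith

/-- Here F = Tr(L²τ) equals -i Tr([L,N]τ), so Cauchy–Schwarz gives F ≤ 2√F √Tr(N²τ). The bound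
serves to make the supremum defining Δ finite. -/
theorem qfi_le {τ : Matrix a a ℂ} (hτ : τ.PosSemidef) {N : Matrix a a ℂ}
    (hN : N.IsHermitian) : qfi τ N ≤ 4 * (N * N * τ).trace.re := by
  obtain ⟨L, hL⟩ := exists_isSLD hτ hN
  have e2 : qfi τ N = (L * L * τ).trace.re := by rw [qfi_eq hL, Matrix.trace_mul_comm]
  have e : (L * L * τ).trace = -Complex.I * ((L * N * τ).trace - (N * L * τ).trace) := by
    have h1 : (L * (N * τ - τ * N)).trace = (L * N * τ).trace - (N * L * τ).trace := by
      rw [Matrix.mul_sub, Matrix.trace_sub, Matrix.mul_assoc,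
        Matrix.mul_assoc N, Matrix.trace_mul_comm N, Matrix.mul_assoc L τ N]
    have h2 : (L * (L * τ + τ * L)).trace = 2 * (L * L * τ).trace := by
      rw [Matrix.mul_add, Matrix.trace_add, ← Matrix.mul_assoc, ← Matrix.mul_assoc,
        Matrix.trace_mul_comm (L * τ) L, ← Matrix.mul_assoc, two_mul]
    rw [← h1, hL.commutator_eq, Matrix.mul_smul, Matrix.trace_smul, h2, smul_eq_mul]
    linear_combination (L * L * τ).trace * Complex.I_sq
  have h1 := norm_trace_mul_le_of_isHermitian hτ hN hL.1
  have h2 := norm_trace_mul_le_of_isHermitian hτ hL.1 hN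
  have h3 : (L * L * τ).trace.re ≤ ‖(L * L * τ).trace‖ := Complex.re_le_norm _
  rw [e, norm_mul, ← e] at h3
  have h4 := norm_sub_le (L * N * τ).trace (N * L * τ).trace
  have hf : 0 ≤ (L * L * τ).trace.re := e2 ▸ qfi_nonneg hτ hN
  have hg : 0 ≤ (N * N * τ).trace.re := by
    have := Matrix.posSemidef_conjTranspose_mul_self N
    rw [hN.eq] at this
    exact re_trace_mul_nonneg this hτ
  simp only [norm_neg, Complex.norm_I, one_mul] at h3
  rw [e2]
  nlinarith [Real.sq_sqrt hf, Real.sq_sqrt hg, Real.sqrt_nonneg (L * L * τ).trace.re,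
    Real.sqrt_nonneg (N * N * τ).trace.re,
    sq_nonneg (√(L * L * τ).trace.re - 2 * √(N * N * τ).trace.re)]

/-- If L is an SLD for the second factor, then 1 ⊗ L is one for the product. -/
theorem qfi_one_kronecker {ρ : Matrix a a ℂ} (hρ : ρ.trace = 1) {σ X : Matrix b b ℂ}
    (hσ : σ.PosSemidef) (hX : X.IsHermitian) :
    qfi (ρ ⊗ₖ σ) ((1 : Matrix a a ℂ) ⊗ₖ X) = qfi σ X := by
  obtain ⟨L, hL⟩ := exists_isSLD hσ hX
  have h : IsSLD (ρ ⊗ₖ σ) ((1 : Matrix a a ℂ) ⊗ₖ X) ((1 : Matrix a a ℂ) ⊗ₖ L) := by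
    refine ⟨?_, ?_⟩
    · rw [Matrix.IsHermitian, Matrix.conjTranspose_kronecker, hL.1.eq, Matrix.conjTranspose_one]
    · simp only [← Matrix.mul_kronecker_mul, Matrix.one_mul, Matrix.mul_one]
      have e1 : ρ ⊗ₖ (σ * X) - ρ ⊗ₖ (X * σ) = ρ ⊗ₖ (σ * X - X * σ) := by
        rw [sub_eq_iff_eq_add, ← Matrix.kronecker_add, sub_add_cancel]
      rw [e1, ← Matrix.kronecker_add, ← Matrix.kronecker_smul, ← Matrix.kronecker_smul, hL.2]
  rw [qfi_eq h, qfi_eq hL, ← Matrix.mul_kronecker_mul, ← Matrix.mul_kronecker_mul,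
    Matrix.trace_kronecker]
  simp [hρ]

/-- A multiple of the identity can be subtracted from Z without changing the commutator; the centred
W then has W² ≤ (spread/2)², and the two orderings in the commutator restore the factor 2. -/
theorem norm_trace_commutator_le_spread {τ : Matrix a a ℂ} (hτ : IsState τ)
    {D Z : Matrix a a ℂ} (hD : D.IsHermitian) (hZ : Z.IsHermitian) :
    ‖((D * Z - Z * D) * τ).trace‖ ≤ √(D * D * τ).trace.re * spread Z := by
  obtain ⟨c, hc⟩ := exists_centre hZ
  set W := Z - c • (1 : Matrix a a ℂ) with hW
  have hWh : W.IsHermitian := by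
    rw [hW, Matrix.IsHermitian]
    simp [hZ.eq]
  have e : D * Z - Z * D = D * W - W * D := by
    rw [hW]; simp [Matrix.mul_sub, Matrix.sub_mul]
  have hs := spread_nonneg Z
  have hb : √(W * W * τ).trace.re ≤ spread Z / 2 := by
    refine Real.sqrt_le_iff.mpr ⟨by positivity, ?_⟩
    have := re_trace_mul_le hc hτ.1
    rwa [Matrix.smul_mul, Matrix.trace_smul, Complex.smul_re, smul_eq_mul, Matrix.one_mul, hτ.2,
      Complex.one_re, mul_one] at this
  have h1 := norm_trace_mul_le_of_isHermitian hτ.1 hD hWh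
  have h2 := norm_trace_mul_le_of_isHermitian hτ.1 hWh hD
  rw [e, Matrix.sub_mul, Matrix.trace_sub]
  have h3 := norm_sub_le (D * W * τ).trace (W * D * τ).trace
  nlinarith [Real.sqrt_nonneg (D * D * τ).trace.re]

/-- For a projection, only the off-diagonal blocks of Z enter, so both weights w and 1 - w appear.
The factor √(w(1-w)) ≤ 1/2 is the source of Δ_Z/2 in the operator conversion. -/
theorem norm_trace_commutator_projection_le_spread {τ : Matrix a a ℂ} (hτ : IsState τ)
    {Q Z : Matrix a a ℂ} (hQ : Q.IsHermitian) (hQQ : Q * Q = Q) (hZ : Z.IsHermitian) :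
    ‖((Q * Z - Z * Q) * τ).trace‖
      ≤ spread Z * √((Q * τ).trace.re * (1 - (Q * τ).trace.re)) := by
  obtain ⟨c, hc⟩ := exists_centre hZ
  set W := Z - c • (1 : Matrix a a ℂ) with hW
  have hWh : W.IsHermitian := by
    rw [hW, Matrix.IsHermitian]
    simp [hZ.eq]
  obtain ⟨hR, hRR⟩ := projection_one_sub hQ hQQ
  have hq : 0 ≤ (Q * τ).trace.re := re_trace_mul_nonneg (posSemidef_of_projection hQ hQQ) hτ.1
  have e : Q * Z - Z * Q = Qᴴ * (W * (1 - Q)) - (W * (1 - Q))ᴴ * Q := by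
    rw [Matrix.conjTranspose_mul, hR.eq, hQ.eq, hWh.eq, hW]
    simp only [Matrix.mul_sub, Matrix.sub_mul, Matrix.mul_one, Matrix.one_mul, Matrix.mul_smul,
      Matrix.smul_mul, hQQ, Matrix.mul_assoc, sub_self, smul_zero, sub_zero]
    abel
  have hs := spread_nonneg Z
  have hb : √((W * (1 - Q))ᴴ * (W * (1 - Q)) * τ).trace.re
      ≤ spread Z / 2 * √(1 - (Q * τ).trace.re) := by
    rw [← Real.sqrt_sq (by positivity : 0 ≤ spread Z / 2), ← Real.sqrt_mul (sq_nonneg _)]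
    refine Real.sqrt_le_sqrt ?_
    have h1 := hc.conjTranspose_mul_mul_same (1 - Q)
    have h2 : ((1 - Q)ᴴ * ((((spread Z / 2) ^ 2 : ℝ) • (1 : Matrix a a ℂ)) - W * W) * (1 - Q))
        = ((spread Z / 2) ^ 2 : ℝ) • (1 - Q) - (W * (1 - Q))ᴴ * (W * (1 - Q)) := by
      rw [Matrix.conjTranspose_mul, hR.eq, hWh.eq, Matrix.mul_sub (1 - Q), Matrix.sub_mul _ _ (1 - Q),
        Matrix.mul_smul, Matrix.smul_mul, Matrix.mul_one, hRR]
      simp only [Matrix.mul_assoc]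
    rw [h2] at h1
    have := re_trace_mul_le h1 hτ.1
    rwa [Matrix.smul_mul, Matrix.trace_smul, Complex.smul_re, smul_eq_mul, Matrix.sub_mul 1 Q,
      Matrix.one_mul, Matrix.trace_sub, hτ.2, Complex.sub_re, Complex.one_re] at this
  have hQs : (Qᴴ * Q * τ).trace.re = (Q * τ).trace.re := by rw [hQ.eq, hQQ]
  have h1 := norm_trace_mul_le hτ.1 Q (W * (1 - Q))
  have h2 := norm_trace_mul_le hτ.1 (W * (1 - Q)) Q
  rw [hQs] at h1 h2
  rw [e, Matrix.sub_mul, Matrix.trace_sub, Real.sqrt_mul hq]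
  have h3 := norm_sub_le (Qᴴ * (W * (1 - Q)) * τ).trace ((W * (1 - Q))ᴴ * Q * τ).trace
  nlinarith [Real.sqrt_nonneg (Q * τ).trace.re]

/-- The trade-off for a projection `q` and an effect `P` that both commute with parts of the
decomposition `N = V - X - Z`. -/
theorem norm_trace_commutator_le_of_decomposition {τ : Matrix a a ℂ} (hτ : IsState τ)
    {q P V X Z : Matrix a a ℂ} (hq : q.IsHermitian) (hqq : q * q = q) (hP : P.IsHermitian)
    (hPP : (P - P * P).PosSemidef) (hV : V.IsHermitian) (hX : X.IsHermitian)
    (hZ : Z.IsHermitian) (hPV : P * V = V * P) (hqX : q * X = X * q) {ε : ℝ} (hε : 0 ≤ ε)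
    (h : ((((1 - q) * P * (1 - q)) + q * (1 - P) * q) * τ).trace.re ≤ ε ^ 2) :
    ‖((q * (V - X - Z) - (V - X - Z) * q) * τ).trace‖
      ≤ ε * (√(qfi τ (V - X - Z)) + spread Z + √(qfi τ X))
        + spread Z * √((q * τ).trace.re * (1 - (q * τ).trace.re)) := by
  have hD : (q - P).IsHermitian := hq.sub hP
  have hDe : √((q - P) * (q - P) * τ).trace.re ≤ ε := by
    refine Real.sqrt_le_iff.mpr ⟨hε, le_trans (re_trace_mul_le ?_ hτ.1) h⟩
    -- Expanding with q² = q, the error operator minus (q - P)² is exactly P - P².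
    convert hPP using 1
    simp only [Matrix.mul_sub, Matrix.sub_mul, Matrix.mul_one, Matrix.one_mul, hqq]
    abel
  -- [q,N] = [q-P,N] + [P,N], and [P,N] = -[P,X] - [P,Z] because P commutes with V; [q,X] = 0 then
  -- allows -P to be replaced by q - P in the X term at no cost, while in the Z term this costs
  -- [q,Z].
  have e : q * (V - X - Z) - (V - X - Z) * q
      = ((q - P) * (V - X - Z) - (V - X - Z) * (q - P)) + ((q - P) * Z - Z * (q - P))
        + ((q - P) * X - X * (q - P)) - (q * Z - Z * q) := by
    simp only [Matrix.mul_sub, Matrix.sub_mul, hqX, hPV]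
    abel
  have h1 := norm_trace_commutator_le_qfi hτ.1 hD ((hV.sub hX).sub hZ)
  have h2 := norm_trace_commutator_le_spread hτ hD hZ
  have h3 := norm_trace_commutator_le_qfi hτ.1 hD hX
  have h4 := norm_trace_commutator_projection_le_spread hτ hq hqq hZ
  rw [e, Matrix.sub_mul, Matrix.add_mul, Matrix.add_mul, Matrix.trace_sub, Matrix.trace_add,
    Matrix.trace_add]
  refine (norm_sub_le _ _).trans ?_
  refine (add_le_add_left (norm_add₃_le) _).trans ?_
  have h1' := h1.trans (mul_le_mul_of_nonneg_right hDe (Real.sqrt_nonneg _))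
  have h2' := h2.trans (mul_le_mul_of_nonneg_right hDe (spread_nonneg Z))
  have h3' := h3.trans (mul_le_mul_of_nonneg_right hDe (Real.sqrt_nonneg _))
  linarith

end FisherInformation

/-! ### The dilation of the channel and the operator conversion bound. -/

section OperatorConversion

variable {a b a' b' : Type*} [Fintype a] [DecidableEq a] [Fintype b] [DecidableEq b]
  [Fintype a'] [DecidableEq a'] [Fintype b'] [DecidableEq b']

theorem trace_mul_partialTrace (W : Matrix a a ℂ) (M : Matrix (a × b) (a × b) ℂ) :
    (W * partialTrace M).trace = ((W ⊗ₖ (1 : Matrix b b ℂ)) * M).trace := by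
  simp only [Matrix.trace, Matrix.diag, Matrix.mul_apply, partialTrace, Matrix.of_apply,
    Fintype.sum_prod_type, Matrix.kroneckerMap_apply, Matrix.one_apply]
  refine Finset.sum_congr rfl fun i _ => ?_
  simp only [mul_ite, mul_one, mul_zero, ite_mul, zero_mul, Finset.sum_ite_eq, Finset.mem_univ,
    if_true, Finset.mul_sum]
  rw [Finset.sum_comm]

theorem partialTrace_posSemidef {M : Matrix (a × b) (a × b) ℂ} (hM : M.PosSemidef) :
    (partialTrace M).PosSemidef := by
  have : partialTrace M = ∑ k, M.submatrix (fun i => (i, k)) (fun i => (i, k)) := by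
    ext i j
    simp [partialTrace, Matrix.sum_apply]
  rw [this]
  exact Matrix.posSemidef_sum _ fun k _ => hM.submatrix _

theorem trace_partialTrace (M : Matrix (a × b) (a × b) ℂ) :
    (partialTrace M).trace = M.trace := by
  simpa using trace_mul_partialTrace (1 : Matrix a a ℂ) M

/-- The operator `W` on the output system in the Heisenberg picture. -/
def heisenberg (U : Matrix (a' × b') (a × b) ℂ) (W : Matrix a' a' ℂ) :
    Matrix (a × b) (a × b) ℂ :=
  Uᴴ * (W ⊗ₖ (1 : Matrix b' b' ℂ)) * U

/-- The channel's dual has the same expectations as the Heisenberg-evolved operator in the product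
state, which lifts all traces on A to the joint system. -/
theorem trace_dualMap_channel_mul (U : Matrix (a' × b') (a × b) ℂ) (ρB : Matrix b b ℂ)
    (W : Matrix a' a' ℂ) (σ : Matrix a a ℂ) :
    (dualMap (channel U ρB) W * σ).trace = (heisenberg U W * (σ ⊗ₖ ρB)).trace := by
  rw [trace_dualMap_mul]
  change (W * partialTrace (U * (σ ⊗ₖ ρB) * Uᴴ)).trace = _
  rw [trace_mul_partialTrace, heisenberg, Matrix.mul_assoc U, ← Matrix.mul_assoc,
    ← Matrix.mul_assoc, Matrix.trace_mul_comm]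
  simp only [Matrix.mul_assoc]

theorem channel_isState {U : Matrix (a' × b') (a × b) ℂ} (hU : Uᴴ * U = 1)
    {ρB : Matrix b b ℂ} (hρB : IsState ρB) {ρ : Matrix a a ℂ} (hρ : IsState ρ) :
    IsState (channel U ρB ρ) := by
  refine ⟨partialTrace_posSemidef ((hρ.1.kronecker hρB.1).mul_mul_conjTranspose_same U), ?_⟩
  change (partialTrace (U * (ρ ⊗ₖ ρB) * Uᴴ)).trace = 1
  rw [trace_partialTrace, Matrix.trace_mul_comm, ← Matrix.mul_assoc, hU, Matrix.one_mul,
    Matrix.trace_kronecker, hρ.2, hρB.2, one_mul]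

theorem isState_kronecker {ρ : Matrix a a ℂ} {σ : Matrix b b ℂ} (hρ : IsState ρ)
    (hσ : IsState σ) : IsState (ρ ⊗ₖ σ) :=
  ⟨hρ.1.kronecker hσ.1, by rw [Matrix.trace_kronecker, hρ.2, hσ.2, one_mul]⟩

theorem isHermitian_kronecker {M : Matrix a a ℂ} {N : Matrix b b ℂ} (hM : M.IsHermitian)
    (hN : N.IsHermitian) : (M ⊗ₖ N).IsHermitian := by
  rw [Matrix.IsHermitian, Matrix.conjTranspose_kronecker, hM.eq, hN.eq]

theorem heisenberg_isHermitian (U : Matrix (a' × b') (a × b) ℂ) {W : Matrix a' a' ℂ}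
    (hW : W.IsHermitian) : (heisenberg U W).IsHermitian :=
  Matrix.isHermitian_conjTranspose_mul_mul U (isHermitian_kronecker hW Matrix.isHermitian_one)

/-- P - P² = P(1-P)P + (1-P)P(1-P). -/
theorem effect_sub_sq_posSemidef {P : Matrix a a ℂ} (hP : P.PosSemidef)
    (hP' : (1 - P).PosSemidef) : (P - P * P).PosSemidef := by
  have h1 := hP'.conjTranspose_mul_mul_same P
  have h2 := hP.conjTranspose_mul_mul_same (1 - P)
  rw [hP.isHermitian.eq] at h1
  rw [hP'.isHermitian.eq] at h2
  convert h1.add h2 using 1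
  simp only [Matrix.mul_sub, Matrix.sub_mul, Matrix.mul_one, Matrix.one_mul, Matrix.mul_assoc]
  abel

theorem conj_mul_conj {m n : Type*} [Fintype m] [DecidableEq m] [Fintype n]
    {U : Matrix m n ℂ} (hU : U * Uᴴ = 1) (S T : Matrix m m ℂ) :
    (Uᴴ * S * U) * (Uᴴ * T * U) = Uᴴ * (S * T) * U := by
  calc (Uᴴ * S * U) * (Uᴴ * T * U) = Uᴴ * S * (U * Uᴴ) * T * U := by
        simp only [Matrix.mul_assoc]
    _ = Uᴴ * (S * T) * U := by rw [hU, Matrix.mul_one, Matrix.mul_assoc Uᴴ]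

/-- The operator conversion trade-off, with the contribution of the violation `Z` bounded by the
weight of `ρ` on the projection `Q`. -/
theorem operator_conversion
    {U : Matrix (a' × b') (a × b) ℂ} (hU' : U * Uᴴ = 1)
    {ρB : Matrix b b ℂ} (hρB : IsState ρB)
    {XA : Matrix a a ℂ} {XB : Matrix b b ℂ} {XA' : Matrix a' a' ℂ} {XB' : Matrix b' b' ℂ}
    (hXA : XA.IsHermitian) (hXB : XB.IsHermitian)
    (hXA' : XA'.IsHermitian) (hXB' : XB'.IsHermitian)
    {ρ Q : Matrix a a ℂ} {P : Matrix a' a' ℂ} {ε : ℝ} (hρ : IsState ρ) (hQ : Q.IsHermitian)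
    (hQQ : Q * Q = Q) (hP : P.PosSemidef) (hP' : (1 - P).PosSemidef) (hε : 0 ≤ ε)
    (h : (dualMap (channel U ρB) P * ((1 - Q) * ρ * (1 - Q))).trace.re
        + ((1 - dualMap (channel U ρB) P) * (Q * ρ * Q)).trace.re ≤ ε ^ 2) :
    ‖((Q * changeOp (channel U ρB) XA XA' - changeOp (channel U ρB) XA XA' * Q) * ρ).trace‖
      ≤ ε * (stateDelta U ρB XA XA' ρ + spread (violation U XA XB XA' XB') + √(qfi ρB XB))
        + spread (violation U XA XB XA' XB') * √((Q * ρ).trace.re * (1 - (Q * ρ).trace.re)) := by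
  set Z := violation U XA XB XA' XB' with hZ
  set τ := ρ ⊗ₖ ρB with hτdef
  have hτ : IsState τ := isState_kronecker hρ hρB
  set q : Matrix (a × b) (a × b) ℂ := Q ⊗ₖ (1 : Matrix b b ℂ) with hqdef
  set V : Matrix (a × b) (a × b) ℂ := Uᴴ * ((1 : Matrix a' a' ℂ) ⊗ₖ XB') * U with hV
  set X : Matrix (a × b) (a × b) ℂ := (1 : Matrix a a ℂ) ⊗ₖ XB with hX
  -- The definition of the violation, solved for the operator whose Fisher information is Δ_ρ².
  have hN : XA ⊗ₖ (1 : Matrix b b ℂ) - Uᴴ * (XA' ⊗ₖ (1 : Matrix b' b' ℂ)) * U = V - X - Z := by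
    rw [hZ, violation, hV, hX, Matrix.mul_add, Matrix.add_mul]
    abel
  have hq : q.IsHermitian := isHermitian_kronecker hQ Matrix.isHermitian_one
  have hqq : q * q = q := by
    rw [hqdef, ← Matrix.mul_kronecker_mul, hQQ, Matrix.one_mul]
  have hVh : V.IsHermitian :=
    Matrix.isHermitian_conjTranspose_mul_mul U (isHermitian_kronecker Matrix.isHermitian_one hXB')
  have hXh : X.IsHermitian := isHermitian_kronecker Matrix.isHermitian_one hXB
  have hZh : Z.IsHermitian :=
    (Matrix.isHermitian_conjTranspose_mul_mul U
      ((isHermitian_kronecker hXA' Matrix.isHermitian_one).add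
        (isHermitian_kronecker Matrix.isHermitian_one hXB'))).sub
      ((isHermitian_kronecker hXA Matrix.isHermitian_one).add
        (isHermitian_kronecker Matrix.isHermitian_one hXB))
  have hPP : (heisenberg U P - heisenberg U P * heisenberg U P).PosSemidef := by
    have e : heisenberg U P - heisenberg U P * heisenberg U P
        = Uᴴ * ((P - P * P) ⊗ₖ (1 : Matrix b' b' ℂ)) * U := by
      rw [heisenberg, conj_mul_conj hU', ← Matrix.mul_kronecker_mul, Matrix.one_mul,
        ← Matrix.sub_mul, ← Matrix.mul_sub]
      congr 2
      rw [sub_eq_iff_eq_add, ← Matrix.add_kronecker, sub_add_cancel]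
    rw [e]
    exact ((effect_sub_sq_posSemidef hP hP').kronecker
      Matrix.PosSemidef.one).conjTranspose_mul_mul_same U
  have hPV : heisenberg U P * V = V * heisenberg U P := by
    rw [heisenberg, hV, conj_mul_conj hU', conj_mul_conj hU', ← Matrix.mul_kronecker_mul,
      ← Matrix.mul_kronecker_mul]
    simp
  have hqX : q * X = X * q := by
    rw [hqdef, hX, ← Matrix.mul_kronecker_mul, ← Matrix.mul_kronecker_mul]
    simp
  have hQρ : ((Q * ρ) ⊗ₖ ρB) = q * τ := by
    rw [hqdef, hτdef, ← Matrix.mul_kronecker_mul, Matrix.one_mul]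
  have hρQ : ((ρ * Q) ⊗ₖ ρB) = τ * q := by
    rw [hqdef, hτdef, ← Matrix.mul_kronecker_mul, Matrix.mul_one]
  have hweight : (q * τ).trace = (Q * ρ).trace := by
    rw [← hQρ, Matrix.trace_kronecker, hρB.2, mul_one]
  have hY : ∀ σ : Matrix a a ℂ,
      (changeOp (channel U ρB) XA XA' * σ).trace = ((V - X - Z) * (σ ⊗ₖ ρB)).trace := by
    intro σ
    rw [changeOp, Matrix.sub_mul, Matrix.trace_sub, trace_dualMap_channel_mul, ← hN,
      Matrix.sub_mul, Matrix.trace_sub, ← Matrix.mul_kronecker_mul, Matrix.one_mul,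
      Matrix.trace_kronecker, hρB.2, mul_one]
    rfl
  have hlhs : ((Q * changeOp (channel U ρB) XA XA' - changeOp (channel U ρB) XA XA' * Q)
      * ρ).trace = ((q * (V - X - Z) - (V - X - Z) * q) * τ).trace := by
    rw [Matrix.sub_mul, Matrix.trace_sub, Matrix.mul_assoc, Matrix.trace_mul_comm,
      Matrix.mul_assoc, Matrix.mul_assoc _ Q, hY, hY, hQρ, hρQ, Matrix.sub_mul (q * _) _ τ, Matrix.trace_sub,
      Matrix.mul_assoc q, Matrix.trace_mul_comm q, Matrix.mul_assoc _ τ q, Matrix.mul_assoc _ q τ]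
  have hcond : ((((1 - q) * heisenberg U P * (1 - q)) + q * (1 - heisenberg U P) * q)
      * τ).trace.re ≤ ε ^ 2 := by
    refine le_of_eq_of_le ?_ h
    have e1 : (dualMap (channel U ρB) P * ((1 - Q) * ρ * (1 - Q))).trace
        = ((1 - q) * heisenberg U P * (1 - q) * τ).trace := by
      have hq1 : 1 - q = (1 - Q) ⊗ₖ (1 : Matrix b b ℂ) := by
        rw [hqdef, sub_eq_iff_eq_add, ← Matrix.add_kronecker, sub_add_cancel,
          Matrix.one_kronecker_one]
      have : ((1 - Q) * ρ * (1 - Q)) ⊗ₖ ρB = (1 - q) * τ * (1 - q) := by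
        rw [hq1, hτdef, ← Matrix.mul_kronecker_mul, ← Matrix.mul_kronecker_mul, Matrix.one_mul,
          Matrix.mul_one]
      rw [trace_dualMap_channel_mul, this, ← Matrix.mul_assoc, Matrix.trace_mul_comm]
      simp only [Matrix.mul_assoc]
    have e2 : ((1 - dualMap (channel U ρB) P) * (Q * ρ * Q)).trace
        = (q * (1 - heisenberg U P) * q * τ).trace := by
      have : (Q * ρ * Q) ⊗ₖ ρB = q * τ * q := by
        rw [hqdef, hτdef, ← Matrix.mul_kronecker_mul, ← Matrix.mul_kronecker_mul, Matrix.one_mul,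
          Matrix.mul_one]
      have h1 : (Q * ρ * Q).trace = (q * τ * q).trace := by
        rw [← this, Matrix.trace_kronecker, hρB.2, mul_one]
      have h2 : (q * (1 - heisenberg U P) * q * τ).trace
          = ((1 - heisenberg U P) * (q * τ * q)).trace := by
        simp only [Matrix.mul_assoc]
        rw [Matrix.trace_mul_comm q]
        simp only [Matrix.mul_assoc]
      rw [h2, Matrix.sub_mul, Matrix.trace_sub, Matrix.one_mul, h1, trace_dualMap_channel_mul,
        this, Matrix.sub_mul, Matrix.trace_sub, Matrix.one_mul]
    rw [e1, e2, ← Complex.add_re, ← Matrix.trace_add, ← Matrix.add_mul]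
  have main := norm_trace_commutator_le_of_decomposition hτ hq hqq
    (heisenberg_isHermitian U hP.isHermitian) hPP hVh hXh hZh hPV hqX hε hcond
  rw [hlhs, stateDelta, hN, ← qfi_one_kronecker (ρ := ρ) hρ.2 hρB.1 hXB, ← hweight]
  exact main

theorem stateDelta_nonneg (U : Matrix (a' × b') (a × b) ℂ) (ρB : Matrix b b ℂ)
    (XA : Matrix a a ℂ) (XA' : Matrix a' a' ℂ) (ρ : Matrix a a ℂ) :
    0 ≤ stateDelta U ρB XA XA' ρ := Real.sqrt_nonneg _

/-- Every eigenvalue of a positive matrix is at most the sum of all of them. -/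
theorem posSemidef_trace_smul_one_sub {M : Matrix a a ℂ} (hM : M.PosSemidef) :
    (M.trace.re • (1 : Matrix a a ℂ) - M).PosSemidef := by
  have hM' := hM.isHermitian
  have hf : (spectrum ℝ M).Finite := Matrix.finite_real_spectrum
  have hid : cfc (fun x : ℝ => x) M = M := cfc_id' ℝ M hM'
  have hconst : cfc (fun _ : ℝ => M.trace.re) M = M.trace.re • (1 : Matrix a a ℂ) :=
    (cfc_const _ M hM').trans (Algebra.algebraMap_eq_smul_one _)
  have htr : M.trace.re = ∑ i, hM'.eigenvalues i := by
    rw [hM'.trace_eq_sum_eigenvalues]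
    simp
  have e : M.trace.re • (1 : Matrix a a ℂ) - M = cfc (fun x : ℝ => M.trace.re - x) M := by
    rw [cfc_sub _ _ M (hf.continuousOn _) (hf.continuousOn _), hid, hconst]
  rw [e]
  refine Matrix.nonneg_iff_posSemidef.mp (cfc_nonneg fun x hx => ?_)
  rw [hM'.spectrum_real_eq_range_eigenvalues] at hx
  obtain ⟨i, rfl⟩ := hx
  rw [htr, sub_nonneg]
  exact Finset.single_le_sum (fun j _ => hM.eigenvalues_nonneg j) (Finset.mem_univ i)

/-- The point is boundedness of the set, without which the real `sSup` would be 0: F ≤ 4 Tr(N²τ) ≤ 4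
Tr(N²) for every state τ. -/
theorem stateDelta_le_ensembleDelta {κ : Type*}
    {U : Matrix (a' × b') (a × b) ℂ} {ρB : Matrix b b ℂ} (hρB : IsState ρB)
    {XA : Matrix a a ℂ} {XA' : Matrix a' a' ℂ} (hXA : XA.IsHermitian) (hXA' : XA'.IsHermitian)
    {ρ : κ → Matrix a a ℂ} {σ : Matrix a a ℂ} (hσ : IsState σ)
    (hσρ : LinearMap.range σ.mulVecLin ≤ ⨆ k, LinearMap.range (ρ k).mulVecLin) :
    stateDelta U ρB XA XA' σ ≤ ensembleDelta U ρB XA XA' ρ := by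
  refine le_csSup ?_ ⟨σ, hσ, hσρ, rfl⟩
  set N := XA ⊗ₖ (1 : Matrix b b ℂ) - Uᴴ * (XA' ⊗ₖ (1 : Matrix b' b' ℂ)) * U with hN
  have hNh : N.IsHermitian :=
    (isHermitian_kronecker hXA Matrix.isHermitian_one).sub (heisenberg_isHermitian U hXA')
  refine ⟨√(4 * (N * N).trace.re), ?_⟩
  rintro _ ⟨τ, hτ, -, rfl⟩
  refine Real.sqrt_le_sqrt ((qfi_le (hτ.1.kronecker hρB.1) hNh).trans ?_)
  have hNN : (N * N).PosSemidef := by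
    have := Matrix.posSemidef_conjTranspose_mul_self N
    rwa [hNh.eq] at this
  have := re_trace_mul_le (posSemidef_trace_smul_one_sub hNN) (hτ.1.kronecker hρB.1)
  rw [Matrix.smul_mul, Matrix.one_mul, Matrix.trace_smul, (isState_kronecker hτ hρB).2,
    Complex.smul_re, smul_eq_mul, Complex.one_re, mul_one] at this
  linarith

end OperatorConversion

/-! ### States with prescribed diagonal blocks and maximal coherence. -/

section CoherentState

variable {a : Type*} [Fintype a] [DecidableEq a]

theorem posSemidef_one_sub_of_trace_le {M : Matrix a a ℂ} (hM : M.PosSemidef)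
    (h : M.trace.re ≤ 1) : (1 - M).PosSemidef := by
  have h1 : ((1 - M.trace.re) • (1 : Matrix a a ℂ)).PosSemidef :=
    Matrix.PosSemidef.one.smul (sub_nonneg.mpr h)
  convert h1.add (posSemidef_trace_smul_one_sub hM) using 1
  rw [sub_smul, one_smul]
  abel

theorem mul_eq_zero_of_conjTranspose {M N : Matrix a a ℂ} (hM : M.IsHermitian)
    (hN : N.IsHermitian) (h : M * N = 0) : N * M = 0 := by
  have := congrArg Matrix.conjTranspose h
  rwa [Matrix.conjTranspose_mul, hM.eq, hN.eq, Matrix.conjTranspose_zero] at this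

/-- Two orthogonal positive operators `α`, `β` are the diagonal blocks of a state whose
off-diagonal blocks detect the full Hilbert–Schmidt norm of the off-diagonal part of `Y`. -/
theorem exists_coherent_state {α β Q Y : Matrix a a ℂ} (hα : α.PosSemidef) (hβ : β.PosSemidef)
    (htr : α.trace + β.trace = 1) (hQ : Q.IsHermitian) (hQα : Q * α = α)
    (hQβ : Q * β = 0) (hY : Y.IsHermitian) :
    ∃ σ : Matrix a a ℂ, IsState σ ∧ (Q * σ).trace = α.trace ∧ Q * σ * Q = α ∧
      (1 - Q) * σ * (1 - Q) = β ∧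
      LinearMap.range σ.mulVecLin ≤ LinearMap.range α.mulVecLin ⊔ LinearMap.range β.mulVecLin ∧
      ‖((Q * Y - Y * Q) * σ).trace‖ = 2 * √(α * Y * β * Y).trace.re := by
  set s := sqrtMat α with hs
  set t := sqrtMat β with ht
  have hsh : sᴴ = s := (sqrtMat_posSemidef α).isHermitian.eq
  have hth : tᴴ = t := (sqrtMat_posSemidef β).isHermitian.eq
  have hss : s * s = α := sqrtMat_mul_self hα
  have htt : t * t = β := sqrtMat_mul_self hβ
  have hsQ : s * Q = s := by
    have h1 : α * (1 - Q) = 0 := by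
      refine mul_eq_zero_of_conjTranspose (Matrix.isHermitian_one.sub hQ) hα.isHermitian ?_
      rw [Matrix.sub_mul, Matrix.one_mul, hQα, sub_self]
    have h2 := sqrtMat_mul_eq_zero hα h1
    rw [Matrix.mul_sub, Matrix.mul_one, sub_eq_zero] at h2
    exact h2.symm
  have hQs : Q * s = s := by
    have := congrArg Matrix.conjTranspose hsQ
    rwa [Matrix.conjTranspose_mul, hsh, hQ.eq] at this
  have htQ : t * Q = 0 :=
    sqrtMat_mul_eq_zero hβ (mul_eq_zero_of_conjTranspose hQ hβ.isHermitian hQβ)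
  have hQt : Q * t = 0 :=
    mul_eq_zero_of_conjTranspose (sqrtMat_posSemidef β).isHermitian hQ htQ
  have hαQ : α * Q = α := by rw [← hss, Matrix.mul_assoc, hsQ]
  have hβQ : β * Q = 0 := by rw [← htt, Matrix.mul_assoc, htQ, Matrix.mul_zero]
  have hts : t * s = 0 := by rw [← hQs, ← Matrix.mul_assoc, htQ, Matrix.zero_mul]
  set G := s * Y * t with hG
  have hGh : Gᴴ = t * Y * s := by
    rw [hG, Matrix.conjTranspose_mul, Matrix.conjTranspose_mul, hsh, hth, hY.eq, Matrix.mul_assoc]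
  have hGG : (Gᴴ * G).trace = (α * Y * β * Y).trace := by
    calc (Gᴴ * G).trace = (t * (Y * (s * s) * Y * t)).trace := by
          rw [hGh, hG]; simp only [Matrix.mul_assoc]
      _ = (Y * (α * Y * β)).trace := by
          rw [Matrix.trace_mul_comm, hss]
          conv_rhs => rw [← htt]
          simp only [Matrix.mul_assoc]
      _ = (α * Y * β * Y).trace := by rw [Matrix.trace_mul_comm]
  have hGpos := Matrix.posSemidef_conjTranspose_mul_self G
  set g := √(Gᴴ * G).trace.re with hg
  have hgg : (Gᴴ * G).trace = (g : ℂ) * g := by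
    rw [trace_eq_re hGpos, ← Complex.ofReal_mul, hg, Real.mul_self_sqrt (re_trace_nonneg hGpos)]
  -- G normalised in Hilbert–Schmidt norm. The phase i makes the two off-diagonal contributions to
  -- the commutator add up instead of cancelling. If g = 0, division by zero gives W = 0, which is
  -- still correct.
  set W := (Complex.I / g) • G with hW
  have hWh : Wᴴ = (-Complex.I / g) • Gᴴ := by
    rw [hW, Matrix.conjTranspose_smul]
    simp
  -- Hilbert–Schmidt norm at most 1 (it is 1 or 0) makes W a contraction.
  have hWW : (1 - Wᴴ * W).PosSemidef := by
    refine posSemidef_one_sub_of_trace_le (Matrix.posSemidef_conjTranspose_mul_self W) ?_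
    have e : (Wᴴ * W).trace = ((g * g / (g * g) : ℝ) : ℂ) := by
      rw [hWh, hW, Matrix.smul_mul, Matrix.mul_smul, Matrix.trace_smul, Matrix.trace_smul, hgg]
      push_cast
      simp only [smul_eq_mul]
      linear_combination (-(g * g / (g * g) : ℂ)) * Complex.I_sq
    rw [e, Complex.ofReal_re]
    exact div_self_le_one _
  set σ := α + β + s * W * t + t * Wᴴ * s with hσ
  have hQσ : Q * σ = α + s * W * t := by
    rw [hσ]
    simp only [Matrix.mul_add, ← Matrix.mul_assoc, hQα, hQβ, hQs, hQt, Matrix.zero_mul, add_zero]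
  have hσQ : σ * Q = α + t * Wᴴ * s := by
    rw [hσ]
    simp only [Matrix.add_mul, Matrix.mul_assoc, hαQ, hβQ, hsQ, htQ, Matrix.mul_zero, add_zero]
  have htr1 : (s * W * t).trace = 0 := by
    rw [Matrix.trace_mul_comm, ← Matrix.mul_assoc, hts, Matrix.zero_mul, Matrix.trace_zero]
  have htr2 : (t * Wᴴ * s).trace = 0 := by
    have : s * t = 0 := by
      have := congrArg Matrix.conjTranspose hts
      rwa [Matrix.conjTranspose_mul, hsh, hth, Matrix.conjTranspose_zero] at this
    rw [Matrix.trace_mul_comm, ← Matrix.mul_assoc, this, Matrix.zero_mul, Matrix.trace_zero]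
  have hQσQ : Q * σ * Q = α := by
    rw [hQσ, Matrix.add_mul, hαQ, Matrix.mul_assoc, htQ, Matrix.mul_zero, add_zero]
  refine ⟨σ, ⟨?_, ?_⟩, ?_, hQσQ, ?_, ?_, ?_⟩
  -- Completing the square in the block matrix: positivity reduces to W being a contraction.
  · have e : σ = (s + W * t)ᴴ * (s + W * t) + tᴴ * (1 - Wᴴ * W) * t := by
      rw [Matrix.conjTranspose_add, Matrix.conjTranspose_mul, hsh, hth, hσ, ← hss, ← htt]
      simp only [Matrix.add_mul, Matrix.mul_add, Matrix.mul_sub, Matrix.sub_mul, Matrix.mul_one,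
        Matrix.mul_assoc]
      abel
    rw [e]
    exact (Matrix.posSemidef_conjTranspose_mul_self _).add (hWW.conjTranspose_mul_mul_same t)
  · rw [hσ, Matrix.trace_add, Matrix.trace_add, Matrix.trace_add, htr1, htr2, htr]
    simp
  · rw [hQσ, Matrix.trace_add, htr1, add_zero]
  · have e : (1 - Q) * σ * (1 - Q) = σ - Q * σ - σ * Q + Q * σ * Q := by
      simp only [Matrix.mul_sub, Matrix.sub_mul, Matrix.mul_one, Matrix.one_mul]
      abel
    rw [e, hQσQ, hQσ, hσQ, hσ]
    abel
  · have e : σ = s * (s + W * t) + t * (t + Wᴴ * s) := by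
      rw [hσ, Matrix.mul_add, Matrix.mul_add, hss, htt]
      simp only [Matrix.mul_assoc]
      abel
    rw [e]
    refine (range_mulVecLin_add_le _ _).trans (sup_le_sup ?_ ?_)
    · exact (range_mulVecLin_mul_le _ _).trans (range_sqrtMat_le hα)
    · exact (range_mulVecLin_mul_le _ _).trans (range_sqrtMat_le hβ)
  · have h1 : ((Q * Y - Y * Q) * σ).trace = (Y * (σ * Q)).trace - (Y * (Q * σ)).trace := by
      rw [Matrix.sub_mul, Matrix.trace_sub, Matrix.mul_assoc, Matrix.trace_mul_comm,
        Matrix.mul_assoc, Matrix.mul_assoc]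
    have h2 : (Y * (t * Wᴴ * s)).trace = (Wᴴ * G).trace := by
      rw [Matrix.mul_assoc, ← Matrix.mul_assoc Y, Matrix.trace_mul_comm, Matrix.mul_assoc, hG]
      simp only [Matrix.mul_assoc]
    have h3 : (Y * (s * W * t)).trace = (W * Gᴴ).trace := by
      rw [Matrix.mul_assoc, ← Matrix.mul_assoc Y, Matrix.trace_mul_comm, Matrix.mul_assoc, hGh]
      simp only [Matrix.mul_assoc]
    have h4 : ((Q * Y - Y * Q) * σ).trace = -(2 * Complex.I) * g := by
      rw [h1, hσQ, hQσ, Matrix.mul_add, Matrix.mul_add, Matrix.trace_add, Matrix.trace_add, h2, h3,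
        hWh, hW, Matrix.smul_mul, Matrix.smul_mul, Matrix.trace_smul, Matrix.trace_smul,
        Matrix.trace_mul_comm G, hgg]
      simp only [smul_eq_mul]
      by_cases h0 : (g : ℂ) = 0
      · simp [h0]
      · field_simp
        ring
    rw [h4, ← hGG, ← hg]
    simp [abs_of_nonneg (Real.sqrt_nonneg _), hg]

end CoherentState

/-! ### Fidelity, orthogonality and two-outcome measurements. -/

section Fidelity

variable {a : Type*} [Fintype a] [DecidableEq a]

theorem fidelity_nonneg (ρ σ : Matrix a a ℂ) : 0 ≤ fidelity ρ σ :=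
  re_trace_nonneg (sqrtMat_posSemidef _)

theorem sqrt_mul_mul_sqrt_posSemidef (ρ : Matrix a a ℂ) {σ : Matrix a a ℂ}
    (hσ : σ.PosSemidef) : (sqrtMat ρ * σ * sqrtMat ρ).PosSemidef := by
  have := hσ.conjTranspose_mul_mul_same (sqrtMat ρ)
  rwa [(sqrtMat_posSemidef ρ).isHermitian.eq] at this

/-- A positive matrix of trace zero vanishes, so √ρ σ √ρ = 0; this is the square |√σ√ρ|², hence √σ√ρ
= 0. -/
theorem mul_eq_zero_of_fidelity_eq_zero {ρ σ : Matrix a a ℂ} (hρ : ρ.PosSemidef)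
    (hσ : σ.PosSemidef) (h : fidelity ρ σ = 0) : ρ * σ = 0 := by
  have hpos := sqrt_mul_mul_sqrt_posSemidef ρ hσ
  have h1 : sqrtMat (sqrtMat ρ * σ * sqrtMat ρ) = 0 := by
    rw [← (sqrtMat_posSemidef _).trace_eq_zero_iff, trace_eq_re (sqrtMat_posSemidef _)]
    exact_mod_cast h
  have h2 := sqrtMat_mul_self hpos
  rw [h1, Matrix.mul_zero] at h2
  have h3 : sqrtMat σ * sqrtMat ρ = 0 := by
    refine eq_zero_of_conjTranspose_mul_self ?_
    rw [Matrix.conjTranspose_mul, (sqrtMat_posSemidef ρ).isHermitian.eq,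
      (sqrtMat_posSemidef σ).isHermitian.eq, Matrix.mul_assoc, ← Matrix.mul_assoc (sqrtMat σ),
      sqrtMat_mul_self hσ, ← Matrix.mul_assoc, ← h2]
  have h4 : σ * ρ = 0 := by
    rw [← sqrtMat_mul_self hσ, ← sqrtMat_mul_self hρ, Matrix.mul_assoc,
      ← Matrix.mul_assoc (sqrtMat σ) (sqrtMat ρ), h3, Matrix.zero_mul, Matrix.mul_zero]
  exact mul_eq_zero_of_conjTranspose hσ.isHermitian hρ.isHermitian h4

/-- A polar decomposition: the fidelity is attained by a contraction. -/
theorem exists_contraction_fidelity (ρ : Matrix a a ℂ) {σ : Matrix a a ℂ} (hσ : σ.PosSemidef) :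
    ∃ V : Matrix a a ℂ, (1 - V * Vᴴ).PosSemidef ∧
      fidelity ρ σ = (V * sqrtMat σ * sqrtMat ρ).trace.re := by
  set M := sqrtMat ρ * σ * sqrtMat ρ with hM
  have hpos : M.PosSemidef := sqrt_mul_mul_sqrt_posSemidef ρ hσ
  have hid : cfc (fun x : ℝ => x) M = M := cfc_id' ℝ M hpos.isHermitian
  have hf : (spectrum ℝ M).Finite := Matrix.finite_real_spectrum
  have hspec : ∀ x ∈ spectrum ℝ M, 0 ≤ x := fun x hx =>
    spectrum_nonneg_of_nonneg (Matrix.nonneg_iff_posSemidef.mpr hpos) hx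
  -- The inverse of √M on its support and 0 elsewhere, so that H√ρ√σ is the polar contraction of
  -- √ρ√σ.
  set H := cfc (fun x : ℝ => (√x)⁻¹) M with hH
  have hHh : Hᴴ = H := (cfc_predicate (fun x : ℝ => (√x)⁻¹) M : Matrix.IsHermitian _)
  have hB : (sqrtMat ρ * sqrtMat σ) * (sqrtMat σ * sqrtMat ρ) = M := by
    rw [Matrix.mul_assoc, ← Matrix.mul_assoc (sqrtMat σ), sqrtMat_mul_self hσ, hM,
      Matrix.mul_assoc]
  refine ⟨H * (sqrtMat ρ * sqrtMat σ), ?_, ?_⟩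
  · have e : H * (sqrtMat ρ * sqrtMat σ) * (H * (sqrtMat ρ * sqrtMat σ))ᴴ = H * M * H := by
      rw [← hB, Matrix.conjTranspose_mul, Matrix.conjTranspose_mul, hHh,
        (sqrtMat_posSemidef ρ).isHermitian.eq, (sqrtMat_posSemidef σ).isHermitian.eq]
      simp only [Matrix.mul_assoc]
    have e2 : H * M * H = cfc (fun x : ℝ => (√x)⁻¹ * x * (√x)⁻¹) M := by
      rw [← cfc_mul_cfc, ← cfc_mul_cfc, hid]
    have h1 : cfc (fun _ : ℝ => (1 : ℝ)) M = 1 := cfc_const_one ℝ M hpos.isHermitian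
    rw [e, e2, ← h1, ← cfc_sub _ _ M (hf.continuousOn _) (hf.continuousOn _)]
    refine Matrix.nonneg_iff_posSemidef.mp (cfc_nonneg fun x hx => ?_)
    rcases eq_or_ne x 0 with rfl | h0
    · simp
    · have hx0 : 0 < x := lt_of_le_of_ne (hspec x hx) (Ne.symm h0)
      have hsq := Real.mul_self_sqrt hx0.le
      have hs0 : √x ≠ 0 := (Real.sqrt_pos.mpr hx0).ne'
      have : (√x)⁻¹ * x * (√x)⁻¹ = 1 := by
        field_simp
        linarith [Real.sq_sqrt hx0.le]
      rw [this, sub_self]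
  · have e : H * (sqrtMat ρ * sqrtMat σ) * sqrtMat σ * sqrtMat ρ = H * M := by
      rw [← hB]; simp only [Matrix.mul_assoc]
    have e2 : H * M = sqrtMat M := by
      conv_lhs => rw [hH]; enter [2]; rw [← hid]
      rw [cfc_mul_cfc, sqrtMat]
      refine cfc_congr fun x hx => ?_
      rcases eq_or_ne x 0 with rfl | h0
      · simp
      · have hx0 : 0 < x := lt_of_le_of_ne (hspec x hx) (Ne.symm h0)
        have hs0 : √x ≠ 0 := (Real.sqrt_pos.mpr hx0).ne'
        change (√x)⁻¹ * x = √x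
        field_simp
        linarith [Real.sq_sqrt hx0.le]
    rw [e, e2, fidelity]

/-- Hilbert–Schmidt Cauchy–Schwarz between V†√ρQ and √σQ; the contraction is then dropped from the
first norm. -/
theorem norm_trace_contraction_le {ρ σ V Q : Matrix a a ℂ} (hρ : ρ.PosSemidef)
    (hσ : σ.PosSemidef) (hV : (1 - V * Vᴴ).PosSemidef) (hQ : Q.IsHermitian) (hQQ : Q * Q = Q) :
    ‖(V * sqrtMat σ * Q * sqrtMat ρ).trace‖ ≤ √(Q * ρ).trace.re * √(Q * σ).trace.re := by
  have hρs := (sqrtMat_posSemidef ρ).isHermitian.eq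
  have hσs := (sqrtMat_posSemidef σ).isHermitian.eq
  have hcomp : ∀ τ : Matrix a a ℂ, τ.PosSemidef →
      (Q * sqrtMat τ * (sqrtMat τ * Q)).trace = (Q * τ).trace := by
    intro τ hτ
    rw [Matrix.mul_assoc, ← Matrix.mul_assoc (sqrtMat τ), sqrtMat_mul_self hτ,
      Matrix.trace_mul_comm, Matrix.mul_assoc, hQQ, Matrix.trace_mul_comm]
  have h := norm_trace_conjTranspose_mul_le (Vᴴ * (sqrtMat ρ * Q)) (sqrtMat σ * Q)
  have e1 : ((Vᴴ * (sqrtMat ρ * Q))ᴴ * (sqrtMat σ * Q)).trace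
      = (V * sqrtMat σ * Q * sqrtMat ρ).trace := by
    rw [Matrix.conjTranspose_mul, Matrix.conjTranspose_mul, hρs, hQ.eq,
      Matrix.conjTranspose_conjTranspose]
    calc (Q * sqrtMat ρ * V * (sqrtMat σ * Q)).trace
        = (Q * (sqrtMat ρ * V * (sqrtMat σ * Q))).trace := by simp only [Matrix.mul_assoc]
      _ = (sqrtMat ρ * (V * sqrtMat σ * (Q * Q))).trace := by
          rw [Matrix.trace_mul_comm]; simp only [Matrix.mul_assoc]
      _ = _ := by rw [hQQ, Matrix.trace_mul_comm]
  have e2 : ((sqrtMat σ * Q)ᴴ * (sqrtMat σ * Q)).trace = (Q * σ).trace := by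
    rw [Matrix.conjTranspose_mul, hσs, hQ.eq, hcomp σ hσ]
  have e3 : ((Vᴴ * (sqrtMat ρ * Q))ᴴ * (Vᴴ * (sqrtMat ρ * Q))).trace.re
      ≤ (Q * ρ).trace.re := by
    have h1 := re_trace_mul_le hV
      (Matrix.posSemidef_self_mul_conjTranspose (sqrtMat ρ * Q))
    have h2 : ((1 : Matrix a a ℂ) * ((sqrtMat ρ * Q) * (sqrtMat ρ * Q)ᴴ)).trace
        = (Q * ρ).trace := by
      rw [Matrix.one_mul, Matrix.trace_mul_comm, Matrix.conjTranspose_mul, hρs, hQ.eq, hcomp ρ hρ]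
    rw [h2] at h1
    refine le_of_eq_of_le ?_ h1
    rw [Matrix.conjTranspose_mul Vᴴ, Matrix.conjTranspose_conjTranspose, Matrix.mul_assoc,
      Matrix.trace_mul_comm]
    simp only [Matrix.mul_assoc]
  rw [e1, e2] at h
  exact h.trans (mul_le_mul_of_nonneg_right (Real.sqrt_le_sqrt e3) (Real.sqrt_nonneg _))

/-- The fidelity does not decrease under a two-outcome projective measurement. -/
theorem fidelity_le_of_projection {ρ σ Q : Matrix a a ℂ} (hρ : ρ.PosSemidef)
    (hσ : σ.PosSemidef) (hQ : Q.IsHermitian) (hQQ : Q * Q = Q) :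
    fidelity ρ σ ≤ √(Q * ρ).trace.re * √(Q * σ).trace.re
      + √((1 - Q) * ρ).trace.re * √((1 - Q) * σ).trace.re := by
  obtain ⟨V, hV, hF⟩ := exists_contraction_fidelity ρ hσ
  obtain ⟨hR, hRR⟩ := projection_one_sub hQ hQQ
  have e : (V * sqrtMat σ * sqrtMat ρ).trace = (V * sqrtMat σ * Q * sqrtMat ρ).trace
      + (V * sqrtMat σ * (1 - Q) * sqrtMat ρ).trace := by
    rw [← Matrix.trace_add, ← Matrix.add_mul, ← Matrix.mul_add, add_sub_cancel, Matrix.mul_one]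
  rw [hF, e]
  refine (Complex.re_le_norm _).trans ((norm_add_le _ _).trans ?_)
  exact add_le_add (norm_trace_contraction_le hρ hσ hV hQ hQQ)
    (norm_trace_contraction_le hρ hσ hV hR hRR)

theorem re_trace_projection_mem {ρ Q : Matrix a a ℂ} (hρ : IsState ρ) (hQ : Q.IsHermitian)
    (hQQ : Q * Q = Q) : 0 ≤ (Q * ρ).trace.re ∧ (Q * ρ).trace.re ≤ 1 ∧
      ((1 - Q) * ρ).trace.re = 1 - (Q * ρ).trace.re := by
  have h1 := re_trace_mul_nonneg (posSemidef_of_projection hQ hQQ) hρ.1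
  obtain ⟨hR, hRR⟩ := projection_one_sub hQ hQQ
  have h2 := re_trace_mul_nonneg (posSemidef_of_projection hR hRR) hρ.1
  have h3 : ((1 - Q) * ρ).trace.re = 1 - (Q * ρ).trace.re := by
    rw [Matrix.sub_mul, Matrix.one_mul, Matrix.trace_sub, hρ.2, Complex.sub_re, Complex.one_re]
  exact ⟨h1, by linarith, h3⟩

/-- For outcome probabilities q and s, squaring the measured fidelity and applying AM–GM to the
cross term leaves exactly 1 - (q-s)². -/
theorem sq_add_fidelity_sq_le {ρ σ Q : Matrix a a ℂ} (hρ : IsState ρ) (hσ : IsState σ)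
    (hQ : Q.IsHermitian) (hQQ : Q * Q = Q) :
    ((Q * ρ).trace.re - (Q * σ).trace.re) ^ 2 + fidelity ρ σ ^ 2 ≤ 1 := by
  obtain ⟨h1, h2, h3⟩ := re_trace_projection_mem hρ hQ hQQ
  obtain ⟨h4, h5, h6⟩ := re_trace_projection_mem hσ hQ hQQ
  have h := fidelity_le_of_projection hρ.1 hσ.1 hQ hQQ
  rw [h3, h6] at h
  set q := (Q * ρ).trace.re
  set s := (Q * σ).trace.re
  have hF := fidelity_nonneg ρ σ
  have hq := Real.sq_sqrt h1
  have hs := Real.sq_sqrt h4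
  have hq' := Real.sq_sqrt (sub_nonneg.mpr h2)
  have hs' := Real.sq_sqrt (sub_nonneg.mpr h5)
  have h7 := pow_le_pow_left₀ hF h 2
  have h8 : (√q * √s + √(1 - q) * √(1 - s)) ^ 2
      = q * s + (1 - q) * (1 - s) + 2 * ((√q * √(1 - q)) * (√s * √(1 - s))) := by
    rw [add_sq, mul_pow, mul_pow, hq, hs, hq', hs']
    ring
  have h9 : 2 * ((√q * √(1 - q)) * (√s * √(1 - s))) ≤ q * (1 - q) + s * (1 - s) := by
    have h10 := two_mul_le_add_sq (√q * √(1 - q)) (√s * √(1 - s))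
    rw [mul_pow, mul_pow, hq, hs, hq', hs'] at h10
    linarith
  nlinarith

theorem purifiedDist_nonneg (ρ σ : Matrix a a ℂ) : 0 ≤ purifiedDist ρ σ := Real.sqrt_nonneg _

theorem re_trace_projection_sub_le_purifiedDist {ρ σ Q : Matrix a a ℂ} (hρ : IsState ρ)
    (hσ : IsState σ) (hQ : Q.IsHermitian) (hQQ : Q * Q = Q) :
    |(Q * ρ).trace.re - (Q * σ).trace.re| ≤ purifiedDist ρ σ :=
  Real.abs_le_sqrt (by linarith [sq_add_fidelity_sq_le hρ hσ hQ hQQ])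

/-- When Q is certain on ρ, the measured fidelity is only √Tr(Qσ). The bound is therefore quadratic
in D_F, unlike `re_trace_projection_sub_le_purifiedDist`. -/
theorem one_sub_re_trace_support_le {ρ σ Q : Matrix a a ℂ} (hρ : IsState ρ)
    (hσ : IsState σ) (hQ : Q.IsHermitian) (hQQ : Q * Q = Q) (hQρ : Q * ρ = ρ) :
    1 - (Q * σ).trace.re ≤ purifiedDist ρ σ ^ 2 := by
  have h := fidelity_le_of_projection hρ.1 hσ.1 hQ hQQ
  obtain ⟨-, -, h3⟩ := re_trace_projection_mem hρ hQ hQQ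
  obtain ⟨h4, h5, -⟩ := re_trace_projection_mem hσ hQ hQQ
  rw [h3, hQρ, hρ.2, Complex.one_re, sub_self, Real.sqrt_one, Real.sqrt_zero, one_mul, zero_mul,
    add_zero] at h
  have h7 := pow_le_pow_left₀ (fidelity_nonneg ρ σ) h 2
  rw [Real.sq_sqrt h4] at h7
  rw [purifiedDist, Real.sq_sqrt (by linarith)]
  linarith

end Fidelity

/-! ### Recovery maps and pulled-back effects. -/

section Recovery

variable {a b : Type*} [Fintype a] [DecidableEq a] [Fintype b] [DecidableEq b]

theorem trace_mul_nonneg {A τ : Matrix a a ℂ} (hA : A.PosSemidef) (hτ : τ.PosSemidef) :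
    0 ≤ (A * τ).trace := by
  obtain ⟨S, rfl⟩ := exists_eq_conjTranspose_mul_self hτ
  rw [← Matrix.mul_assoc, Matrix.trace_mul_comm, ← Matrix.mul_assoc]
  exact (hA.mul_mul_conjTranspose_same S).trace_nonneg

theorem IsCPTP.posSemidef {R : Matrix a a ℂ →ₗ[ℂ] Matrix b b ℂ} (hR : IsCPTP R)
    {M : Matrix a a ℂ} (hM : M.PosSemidef) : (R M).PosSemidef :=
  (hR.1 1 _ (hM.submatrix Prod.snd)).submatrix fun i : b => ((0 : Fin 1), i)

theorem IsCPTP.isState {R : Matrix a a ℂ →ₗ[ℂ] Matrix b b ℂ} (hR : IsCPTP R)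
    {ρ : Matrix a a ℂ} (hρ : IsState ρ) : IsState (R ρ) :=
  ⟨hR.posSemidef hρ.1, (hR.2 ρ).trans hρ.2⟩

/-- Positivity of R makes R†(Q) and R†(1-Q) positive, and trace preservation identifies the latter
with 1 - R†(Q). -/
theorem IsCPTP.dualMap_effect {R : Matrix a a ℂ →ₗ[ℂ] Matrix b b ℂ} (hR : IsCPTP R)
    {Q : Matrix b b ℂ} (hQ : Q.PosSemidef) (hQ' : (1 - Q).PosSemidef) :
    (dualMap R Q).PosSemidef ∧ (1 - dualMap R Q).PosSemidef := by
  refine ⟨posSemidef_of_trace_mul_nonneg fun τ hτ => ?_, posSemidef_of_trace_mul_nonneg fun τ hτ => ?_⟩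
  · rw [trace_dualMap_mul]
    exact trace_mul_nonneg hQ (hR.posSemidef hτ)
  · have e : ((1 - dualMap R Q) * τ).trace = ((1 - Q) * R τ).trace := by
      rw [Matrix.sub_mul, Matrix.sub_mul, Matrix.trace_sub, Matrix.trace_sub, trace_dualMap_mul,
        Matrix.one_mul, Matrix.one_mul, hR.2]
    rw [e]
    exact trace_mul_nonneg hQ' (hR.posSemidef hτ)

/-- Discard the input and prepare ρ. This makes the set of recovery errors nonempty. -/
theorem exists_isCPTP {ρ : Matrix b b ℂ} (hρ : IsState ρ) :
    ∃ R : Matrix a a ℂ →ₗ[ℂ] Matrix b b ℂ, IsCPTP R := by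
  refine ⟨(Matrix.traceLinearMap a ℂ ℂ).smulRight ρ, fun n M hM => ?_, fun M => ?_⟩
  · have e : (Matrix.of fun (x y : Fin n × b) => ((Matrix.traceLinearMap a ℂ ℂ).smulRight ρ)
        (Matrix.of fun i j => M (x.1, i) (y.1, j)) x.2 y.2) = partialTrace M ⊗ₖ ρ := rfl
    rw [e]
    exact (partialTrace_posSemidef hM).kronecker hρ.1
  · simp [hρ.2]

end Recovery

/-! ### From a discrimination task to a bound on off-diagonal strength. -/

section EnsembleBounds

variable {a b a' b' κ : Type*} [Fintype a] [DecidableEq a] [Fintype b] [DecidableEq b]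
  [Fintype a'] [DecidableEq a'] [Fintype b'] [DecidableEq b'] [Fintype κ] [DecidableEq κ]

theorem sqrt_mul_one_sub_le_half {q : ℝ} : √(q * (1 - q)) ≤ 1 / 2 := by
  refine Real.sqrt_le_iff.mpr ⟨by norm_num, ?_⟩
  nlinarith [sq_nonneg (q - 1 / 2)]

/-- The factor multiplying the error in the ensemble trade-offs. -/
def tradeoffFactor (U : Matrix (a' × b') (a × b) ℂ) (ρB : Matrix b b ℂ) (XA : Matrix a a ℂ)
    (XB : Matrix b b ℂ) (XA' : Matrix a' a' ℂ) (XB' : Matrix b' b' ℂ) (ρ : κ → Matrix a a ℂ) : ℝ :=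
  ensembleDelta U ρB XA XA' ρ + spread (violation U XA XB XA' XB') + √(qfi ρB XB)

theorem tradeoffFactor_nonneg (U : Matrix (a' × b') (a × b) ℂ) (ρB : Matrix b b ℂ)
    (XA : Matrix a a ℂ) (XB : Matrix b b ℂ) (XA' : Matrix a' a' ℂ) (XB' : Matrix b' b' ℂ)
    (ρ : κ → Matrix a a ℂ) : 0 ≤ tradeoffFactor U ρB XA XB XA' XB' ρ := by
  have h : 0 ≤ ensembleDelta U ρB XA XA' ρ := by
    refine Real.sSup_nonneg ?_
    rintro _ ⟨σ, -, -, rfl⟩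
    exact stateDelta_nonneg U ρB XA XA' σ
  have := spread_nonneg (violation U XA XB XA' XB')
  unfold tradeoffFactor
  positivity

/-- The trade-off for the discrimination of two orthogonal positive operators. -/
theorem discrimination_tradeoff
    {U : Matrix (a' × b') (a × b) ℂ} (hU' : U * Uᴴ = 1)
    {ρB : Matrix b b ℂ} (hρB : IsState ρB)
    {XA : Matrix a a ℂ} {XB : Matrix b b ℂ} {XA' : Matrix a' a' ℂ} {XB' : Matrix b' b' ℂ}
    (hXA : XA.IsHermitian) (hXB : XB.IsHermitian)
    (hXA' : XA'.IsHermitian) (hXB' : XB'.IsHermitian)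
    {Y : Matrix a a ℂ} (hY : Y = changeOp (channel U ρB) XA XA') (hYh : Y.IsHermitian)
    (ρ : κ → Matrix a a ℂ) {α β Q : Matrix a a ℂ} (hα : α.PosSemidef) (hβ : β.PosSemidef)
    (htr : α.trace + β.trace = 1) (hQ : Q.IsHermitian) (hQQ : Q * Q = Q) (hQα : Q * α = α)
    (hQβ : Q * β = 0)
    (hαρ : LinearMap.range α.mulVecLin ≤ ⨆ k, LinearMap.range (ρ k).mulVecLin)
    (hβρ : LinearMap.range β.mulVecLin ≤ ⨆ k, LinearMap.range (ρ k).mulVecLin)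
    {R : Matrix a' a' ℂ →ₗ[ℂ] Matrix a a ℂ} (hR : IsCPTP R) {ε : ℝ} (hε : 0 ≤ ε)
    (h : (Q * R (channel U ρB β)).trace.re
        + (α.trace.re - (Q * R (channel U ρB α)).trace.re) ≤ ε ^ 2) :
    2 * √(α * Y * β * Y).trace.re ≤ ε * tradeoffFactor U ρB XA XB XA' XB' ρ
      + spread (violation U XA XB XA' XB') * √(α.trace.re * (1 - α.trace.re)) := by
  obtain ⟨σ, hσ, hσtr, hσα, hσβ, hσr, hσY⟩ :=
    exists_coherent_state hα hβ htr hQ hQα hQβ hYh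
  -- The effect fed to the operator conversion is P = R†(Q): recover, then test Q.
  have hP := hR.dualMap_effect (posSemidef_of_projection hQ hQQ)
    (posSemidef_of_projection (projection_one_sub hQ hQQ).1 (projection_one_sub hQ hQQ).2)
  have hdual : ∀ M : Matrix a a ℂ, (dualMap (channel U ρB) (dualMap R Q) * M).trace
      = (Q * R (channel U ρB M)).trace := fun M => by
    rw [trace_dualMap_mul, trace_dualMap_mul]
  have main := operator_conversion hU' hρB hXA hXB hXA' hXB' hσ hQ hQQ hP.1 hP.2 hε (by
    rwa [hσα, hσβ, Matrix.sub_mul, Matrix.trace_sub, hdual, hdual, Matrix.one_mul,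
      Complex.sub_re])
  rw [← hY, hσY, hσtr] at main
  refine main.trans ?_
  have hle := stateDelta_le_ensembleDelta (U := U) hρB hXA hXA' hσ
    (hσr.trans (sup_le hαρ hβρ))
  unfold tradeoffFactor
  gcongr

theorem range_smul_le (c : ℂ) (M : Matrix a a ℂ) :
    LinearMap.range (c • M).mulVecLin ≤ LinearMap.range M.mulVecLin := by
  have := range_mulVecLin_mul_le M (c • (1 : Matrix a a ℂ))
  rwa [Matrix.mul_smul, Matrix.mul_one] at this

theorem range_sum_le {S : Submodule ℂ (a → ℂ)} {ι : Type*} (s : Finset ι)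
    (M : ι → Matrix a a ℂ) (h : ∀ i ∈ s, LinearMap.range (M i).mulVecLin ≤ S) :
    LinearMap.range (∑ i ∈ s, M i).mulVecLin ≤ S := by
  rintro _ ⟨x, rfl⟩
  rw [Matrix.mulVecLin_apply, Matrix.sum_mulVec]
  exact S.sum_mem fun i hi => h i hi ⟨x, rfl⟩

/-- Mutually orthogonal projections sum to at most the identity. -/
theorem sum_projection_le_one {Q : κ → Matrix a a ℂ} (hQ : ∀ k, (Q k).IsHermitian)
    (hQQ : ∀ k, Q k * Q k = Q k) (hort : ∀ k k', k ≠ k' → Q k * Q k' = 0) :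
    (1 - ∑ k, Q k).PosSemidef := by
  have hS : (∑ k, Q k).IsHermitian := by
    rw [Matrix.IsHermitian, Matrix.conjTranspose_sum]
    exact Finset.sum_congr rfl fun k _ => (hQ k).eq
  have hSS : (∑ k, Q k) * (∑ k, Q k) = ∑ k, Q k := by
    rw [Finset.sum_mul]
    refine Finset.sum_congr rfl fun k _ => ?_
    rw [Finset.mul_sum, Finset.sum_eq_single k (fun k' _ h => hort k k' h.symm) (by simp), hQQ]
  exact posSemidef_of_projection (projection_one_sub hS hSS).1 (projection_one_sub hS hSS).2

/-- Minkowski's inequality for the root of a finite sum of squares. -/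
theorem sqrt_sum_sq_add_le {ι : Type*} (s : Finset ι) (f g : ι → ℝ) :
    √(∑ i ∈ s, (f i + g i) ^ 2) ≤ √(∑ i ∈ s, f i ^ 2) + √(∑ i ∈ s, g i ^ 2) := by
  have hf : 0 ≤ ∑ i ∈ s, f i ^ 2 := Finset.sum_nonneg fun i _ => sq_nonneg _
  have hg : 0 ≤ ∑ i ∈ s, g i ^ 2 := Finset.sum_nonneg fun i _ => sq_nonneg _
  refine Real.sqrt_le_iff.mpr ⟨by positivity, ?_⟩
  have h := Real.sum_mul_le_sqrt_mul_sqrt s f g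
  have e : ∑ i ∈ s, (f i + g i) ^ 2
      = ∑ i ∈ s, f i ^ 2 + 2 * ∑ i ∈ s, f i * g i + ∑ i ∈ s, g i ^ 2 := by
    rw [Finset.mul_sum, ← Finset.sum_add_distrib, ← Finset.sum_add_distrib]
    exact Finset.sum_congr rfl fun i _ => by ring
  rw [e, add_sq, Real.sq_sqrt hf, Real.sq_sqrt hg]
  linarith

end EnsembleBounds

/-! ### Orthogonal test states. -/

section OrthogonalEnsembles

variable {a b a' b' κ : Type*} [Fintype a] [DecidableEq a] [Fintype b] [DecidableEq b]
  [Fintype a'] [DecidableEq a'] [Fintype b'] [DecidableEq b'] [Fintype κ] [DecidableEq κ]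

theorem conjTranspose_channel (U : Matrix (a' × b') (a × b) ℂ) {ρB : Matrix b b ℂ}
    (hρB : ρB.IsHermitian) (M : Matrix a a ℂ) :
    (channel U ρB M)ᴴ = channel U ρB Mᴴ := by
  have h : (U * (M ⊗ₖ ρB) * Uᴴ)ᴴ = U * (Mᴴ ⊗ₖ ρB) * Uᴴ := by
    rw [Matrix.conjTranspose_mul, Matrix.conjTranspose_mul, Matrix.conjTranspose_kronecker,
      Matrix.conjTranspose_conjTranspose, hρB.eq, Matrix.mul_assoc]
  ext i j
  change star (∑ k, (U * (M ⊗ₖ ρB) * Uᴴ) (j, k) (i, k)) = ∑ k, (U * (Mᴴ ⊗ₖ ρB) * Uᴴ) (i, k) (j, k)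
  rw [← h, star_sum]
  rfl

theorem changeOp_isHermitian (U : Matrix (a' × b') (a × b) ℂ) {ρB : Matrix b b ℂ}
    (hρB : ρB.IsHermitian) {XA : Matrix a a ℂ} {XA' : Matrix a' a' ℂ} (hXA : XA.IsHermitian)
    (hXA' : XA'.IsHermitian) : (changeOp (channel U ρB) XA XA').IsHermitian := by
  refine hXA.sub ?_
  ext i j
  change star (XA' * channel U ρB (Matrix.single i j 1)).trace
    = (XA' * channel U ρB (Matrix.single j i 1)).trace
  rw [← Matrix.trace_conjTranspose, Matrix.conjTranspose_mul, conjTranspose_channel U hρB,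
    hXA'.eq, Matrix.trace_mul_comm, Matrix.conjTranspose_single, star_one]

theorem sum_filter_ne_eq_sub (f : κ → ℝ) (k : κ) :
    ∑ k' ∈ Finset.univ.filter (fun k' => k' ≠ k), f k' = ∑ k', f k' - f k := by
  rw [Finset.filter_ne', Finset.sum_erase_eq_sub (Finset.mem_univ k)]

theorem re_trace_mul_sum {m n ι : Type*} [Fintype m] [Fintype n]
    (Q : Matrix n n ℂ) (Φ : Matrix m m ℂ →ₗ[ℂ] Matrix n n ℂ) (s : Finset ι) (p : ι → ℝ)
    (ρ : ι → Matrix m m ℂ) : (Q * Φ (∑ i ∈ s, (p i : ℂ) • ρ i)).trace.re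
      = ∑ i ∈ s, p i * (Q * Φ (ρ i)).trace.re := by
  rw [map_sum, Matrix.mul_sum, Matrix.trace_sum, Complex.re_sum]
  refine Finset.sum_congr rfl fun i _ => ?_
  rw [map_smul, Matrix.mul_smul, Matrix.trace_smul, smul_eq_mul, Complex.re_ofReal_mul]

theorem posSemidef_ofReal_smul {c : ℝ} (hc : 0 ≤ c) {M : Matrix a a ℂ} (hM : M.PosSemidef) :
    ((c : ℂ) • M).PosSemidef :=
  hM.smul (by exact_mod_cast hc)

/-- For each k, the task is to tell α = p_k ρ_k from the weighted sum β of all other states by the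
support projection of ρ_k. Then 𝒞² = Σ_k Tr(α_k Y β_k Y), so one bound per k suffices instead of one
per pair. -/
theorem offDiag_le_of_orthogonal
    {U : Matrix (a' × b') (a × b) ℂ} (hU : Uᴴ * U = 1) (hU' : U * Uᴴ = 1)
    {ρB : Matrix b b ℂ} (hρB : IsState ρB)
    {XA : Matrix a a ℂ} {XB : Matrix b b ℂ} {XA' : Matrix a' a' ℂ} {XB' : Matrix b' b' ℂ}
    (hXA : XA.IsHermitian) (hXB : XB.IsHermitian)
    (hXA' : XA'.IsHermitian) (hXB' : XB'.IsHermitian)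
    {Y : Matrix a a ℂ} (hY : Y = changeOp (channel U ρB) XA XA')
    {p : κ → ℝ} {ρ : κ → Matrix a a ℂ} (hp : ∀ k, 0 ≤ p k) (hp1 : ∑ k, p k = 1)
    (hρ : ∀ k, IsState (ρ k)) (hort : ∀ k k', k ≠ k' → ρ k * ρ k' = 0)
    {R : Matrix a' a' ℂ →ₗ[ℂ] Matrix a a ℂ} (hR : IsCPTP R) :
    2 * offDiag p ρ Y ≤ √2 * recoveryError (channel U ρB) p ρ R
        * tradeoffFactor U ρB XA XB XA' XB' ρ + spread (violation U XA XB XA' XB') := by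
  have hYh : Y.IsHermitian := hY ▸ changeOp_isHermitian U hρB.1.isHermitian hXA hXA'
  set Z := violation U XA XB XA' XB' with hZ
  set K := tradeoffFactor U ρB XA XB XA' XB' ρ with hK
  have hK0 : 0 ≤ K := tradeoffFactor_nonneg U ρB XA XB XA' XB' ρ
  choose Q hQ hQQ hQρ hQN using fun k => exists_support_projection (hρ k).1.isHermitian
  have hQρ' : ∀ k k', k ≠ k' → Q k * ρ k' = 0 := fun k k' h => hQN k _ (hort k k' h)
  have hQort : ∀ k k', k ≠ k' → Q k * Q k' = 0 := fun k k' h =>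
    hQN k _ (mul_eq_zero_of_conjTranspose (hQ k') (hρ k).1.isHermitian (hQρ' k' k h.symm))
  let Φ : Matrix a a ℂ →ₗ[ℂ] Matrix a a ℂ := R ∘ₗ channel U ρB
  have hΦ : ∀ k, IsState (Φ (ρ k)) := fun k => hR.isState (channel_isState hU hρB (hρ k))
  -- The probability that the test for k accepts the recovered state of k'.
  let s : κ → κ → ℝ := fun k k' => (Q k * Φ (ρ k')).trace.re
  have hs0 : ∀ k k', 0 ≤ s k k' := fun k k' =>
    (re_trace_projection_mem (hΦ k') (hQ k) (hQQ k)).1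
  have hs1 : ∀ k k', s k k' ≤ 1 := fun k k' =>
    (re_trace_projection_mem (hΦ k') (hQ k) (hQQ k)).2.1
  have hssum : ∀ k', ∑ k, s k k' ≤ 1 := fun k' => by
    have := re_trace_mul_le (sum_projection_le_one hQ hQQ hQort) (hΦ k').1
    rwa [Finset.sum_mul, Matrix.trace_sum, Complex.re_sum, Matrix.one_mul, (hΦ k').2,
      Complex.one_re] at this
  let rest : κ → Finset κ := fun k => Finset.univ.filter (fun k' => k' ≠ k)
  let α : κ → Matrix a a ℂ := fun k => (p k : ℂ) • ρ k
  let β : κ → Matrix a a ℂ := fun k => ∑ k' ∈ rest k, (p k' : ℂ) • ρ k'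
  have hαpos : ∀ k, (α k).PosSemidef := fun k => posSemidef_ofReal_smul (hp k) (hρ k).1
  have hβpos : ∀ k, (β k).PosSemidef := fun k =>
    Matrix.posSemidef_sum _ fun k' _ => posSemidef_ofReal_smul (hp k') (hρ k').1
  have hαtr : ∀ k, (α k).trace = p k := fun k => by
    simp only [α, Matrix.trace_smul, (hρ k).2, smul_eq_mul, mul_one]
  have htr : ∀ k, (α k).trace + (β k).trace = 1 := fun k => by
    have h1 : (β k).trace = ((∑ k' ∈ rest k, p k' : ℝ) : ℂ) := by
      simp only [β, Matrix.trace_sum, Matrix.trace_smul, (hρ _).2, smul_eq_mul, mul_one,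
        Complex.ofReal_sum]
    rw [h1, hαtr, sum_filter_ne_eq_sub, hp1]
    push_cast
    ring
  have hQα : ∀ k, Q k * α k = α k := fun k => by
    simp only [α, Matrix.mul_smul, hQρ]
  have hQβ : ∀ k, Q k * β k = 0 := fun k => by
    simp only [β, Matrix.mul_sum, Matrix.mul_smul]
    refine Finset.sum_eq_zero fun k' hk' => ?_
    rw [hQρ' k k' (Finset.mem_filter.mp hk').2.symm, smul_zero]
  have hrange : ∀ k, LinearMap.range ((p k : ℂ) • ρ k).mulVecLin
      ≤ ⨆ k, LinearMap.range (ρ k).mulVecLin := fun k =>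
    (range_smul_le _ _).trans (le_iSup (fun k => LinearMap.range (ρ k).mulVecLin) k)
  -- Total error of the test for k: false acceptances plus missed detections.
  let e : κ → ℝ := fun k => (∑ k' ∈ rest k, p k' * s k k') + (p k - p k * s k k)
  have he0 : ∀ k, 0 ≤ e k := fun k => by
    have h1 : 0 ≤ ∑ k' ∈ rest k, p k' * s k k' :=
      Finset.sum_nonneg fun k' _ => mul_nonneg (hp k') (hs0 k k')
    have h2 : p k * s k k ≤ p k * 1 := mul_le_mul_of_nonneg_left (hs1 k k) (hp k)
    simp only [e]
    linarith
  -- The tests are mutually orthogonal, so the false acceptances of a given recovered state total at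
  -- most its probability of being missed. Each kind of error thus contributes one copy of the
  -- squared recovery error.
  have hesum : ∑ k, e k ≤ 2 * recoveryError (channel U ρB) p ρ R ^ 2 := by
    have h1 : ∑ k, e k = ∑ k', p k' * (∑ k, s k k' - s k' k') + ∑ k, p k * (1 - s k k) := by
      simp only [e, rest, sum_filter_ne_eq_sub, mul_sub, Finset.sum_add_distrib,
        Finset.sum_sub_distrib, Finset.mul_sum, mul_one]
      rw [Finset.sum_comm]
    have h2 : ∀ k, p k * (∑ j, s j k - s k k)
        ≤ p k * purifiedDist (ρ k) (Φ (ρ k)) ^ 2 := fun k => by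
      refine mul_le_mul_of_nonneg_left ?_ (hp k)
      have := one_sub_re_trace_support_le (hρ k) (hΦ k) (hQ k) (hQQ k) (hQρ k)
      have h3 := hssum k
      change 1 - s k k ≤ _ at this
      linarith
    have h3 : ∀ k, p k * (1 - s k k) ≤ p k * purifiedDist (ρ k) (Φ (ρ k)) ^ 2 := fun k =>
      mul_le_mul_of_nonneg_left
        (one_sub_re_trace_support_le (hρ k) (hΦ k) (hQ k) (hQQ k) (hQρ k)) (hp k)
    have h4 : recoveryError (channel U ρB) p ρ R ^ 2
        = ∑ k, p k * purifiedDist (ρ k) (Φ (ρ k)) ^ 2 :=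
      Real.sq_sqrt (Finset.sum_nonneg fun k _ => mul_nonneg (hp k) (sq_nonneg _))
    rw [h1, h4, two_mul]
    exact add_le_add (Finset.sum_le_sum fun k _ => h2 k) (Finset.sum_le_sum fun k _ => h3 k)
  let c : κ → ℝ := fun k => (α k * Y * β k * Y).trace.re
  have hc0 : ∀ k, 0 ≤ c k := fun k => by
    have h1 := (hβpos k).conjTranspose_mul_mul_same Y
    rw [hYh.eq] at h1
    have := re_trace_mul_nonneg (hαpos k) h1
    simpa only [c, Matrix.mul_assoc] using this
  have hc : ∀ k, 2 * √(c k) ≤ √(e k) * K + spread Z * √(p k * (1 - p k)) := fun k => by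
    have h1 := discrimination_tradeoff hU' hρB hXA hXB hXA' hXB' hY hYh ρ (hαpos k) (hβpos k)
      (htr k) (hQ k) (hQQ k) (hQα k) (hQβ k) (hrange k)
      (range_sum_le _ _ fun k' _ => hrange k') hR (Real.sqrt_nonneg (e k)) (by
        rw [Real.sq_sqrt (he0 k)]
        refine le_of_eq ?_
        have h2 := re_trace_mul_sum (Q k) Φ (rest k) p ρ
        have h3 : (Q k * Φ (α k)).trace.re = p k * s k k := by
          simp only [α, map_smul, Matrix.mul_smul, Matrix.trace_smul, smul_eq_mul,
            Complex.re_ofReal_mul, s]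
        change (Q k * Φ (β k)).trace.re + ((α k).trace.re - (Q k * Φ (α k)).trace.re) = e k
        rw [h3, hαtr, Complex.ofReal_re]
        simp only [β, h2, e, s])
    rwa [hαtr, Complex.ofReal_re] at h1
  have hoff : offDiag p ρ Y = √(∑ k, c k) := by
    rw [offDiag]
    congr 1
    refine Finset.sum_congr rfl fun k _ => ?_
    simp only [c, α, β, Matrix.mul_sum, Matrix.sum_mul, Matrix.trace_sum, Complex.re_sum]
    refine Finset.sum_congr rfl fun k' hk' => ?_
    have hne : k ≠ k' := (Finset.mem_filter.mp hk').2.symm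
    obtain ⟨h1, h2⟩ := posParts_unique (hρ k).1 (hρ k').1 (hort k k' hne)
    rw [h1, h2]
    simp only [Matrix.smul_mul, Matrix.mul_smul, Matrix.trace_smul, smul_eq_mul,
      Complex.re_ofReal_mul]
    ring
  have hrec : 0 ≤ recoveryError (channel U ρB) p ρ R := Real.sqrt_nonneg _
  have hs := spread_nonneg Z
  calc 2 * offDiag p ρ Y = √(∑ k, (2 * √(c k)) ^ 2) := by
        have h1 : ∑ k, (2 * √(c k)) ^ 2 = 2 ^ 2 * ∑ k, c k := by
          rw [Finset.mul_sum]
          refine Finset.sum_congr rfl fun k _ => ?_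
          rw [mul_pow, Real.sq_sqrt (hc0 k)]
        rw [hoff, h1, Real.sqrt_mul (by norm_num), Real.sqrt_sq (by norm_num)]
    _ ≤ √(∑ k, (√(e k) * K + spread Z * √(p k * (1 - p k))) ^ 2) := by
        refine Real.sqrt_le_sqrt (Finset.sum_le_sum fun k _ => ?_)
        exact pow_le_pow_left₀ (by positivity) (hc k) 2
    _ ≤ √(∑ k, (√(e k) * K) ^ 2) + √(∑ k, (spread Z * √(p k * (1 - p k))) ^ 2) :=
        sqrt_sum_sq_add_le _ _ _
    _ ≤ √2 * recoveryError (channel U ρB) p ρ R * K + spread Z := by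
        refine add_le_add ?_ ?_
        · refine Real.sqrt_le_iff.mpr ⟨by positivity, ?_⟩
          have h1 : ∑ k, (√(e k) * K) ^ 2 = (∑ k, e k) * K ^ 2 := by
            rw [Finset.sum_mul]
            exact Finset.sum_congr rfl fun k _ => by rw [mul_pow, Real.sq_sqrt (he0 k)]
          rw [h1, mul_pow, mul_pow, Real.sq_sqrt (by norm_num)]
          exact mul_le_mul_of_nonneg_right hesum (sq_nonneg K)
        · refine Real.sqrt_le_iff.mpr ⟨hs, ?_⟩
          have hple : ∀ k, p k ≤ 1 := fun k =>
            hp1 ▸ Finset.single_le_sum (fun j _ => hp j) (Finset.mem_univ k)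
          have h1 : ∀ k, (spread Z * √(p k * (1 - p k))) ^ 2 ≤ spread Z ^ 2 * p k := fun k => by
            rw [mul_pow, Real.sq_sqrt (mul_nonneg (hp k) (sub_nonneg.mpr (hple k)))]
            refine mul_le_mul_of_nonneg_left ?_ (sq_nonneg _)
            nlinarith [hp k]
          refine (Finset.sum_le_sum fun k _ => h1 k).trans ?_
          rw [← Finset.mul_sum, hp1, mul_one]

/-- Two distinct weights sum to at most 1, so the smallest weight is at most 1/2. -/
theorem sqrt_two_le_of_ne {p : κ → ℝ} (hp : ∀ k, 0 ≤ p k) (hp1 : ∑ k, p k = 1) {k k' : κ}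
    (h : k ≠ k') : √2 ≤ 2 * √(1 - ⨅ k, p k) := by
  have hb : BddBelow (Set.range p) := (Set.finite_range p).bddBelow
  have h1 := ciInf_le hb k
  have h2 := ciInf_le hb k'
  have h3 : p k + p k' ≤ 1 := by
    rw [← hp1, ← Finset.sum_pair h]
    exact Finset.sum_le_univ_sum_of_nonneg hp
  refine Real.sqrt_le_iff.mpr ⟨by positivity, ?_⟩
  rw [mul_pow, Real.sq_sqrt (by linarith)]
  linarith

end OrthogonalEnsembles

/-! ### Arbitrary test states, treated pair by pair. -/

section GeneralEnsembles

variable {a b a' b' κ : Type*} [Fintype a] [DecidableEq a] [Fintype b] [DecidableEq b]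
  [Fintype a'] [DecidableEq a'] [Fintype b'] [DecidableEq b'] [Fintype κ] [DecidableEq κ]

/-- The trace distance of two states is the trace of either part of their difference. -/
theorem trace_posParts_eq_traceDist {ρ σ : Matrix a a ℂ} (hρ : IsState ρ) (hσ : IsState σ) :
    (positivePart (ρ - σ)).trace = traceDist ρ σ ∧
      (negativePart (ρ - σ)).trace = traceDist ρ σ := by
  have hM : (ρ - σ).IsHermitian := hρ.1.isHermitian.sub hσ.1.isHermitian
  have h1 := congrArg Matrix.trace (positivePart_sub_negativePart hM)
  have h2 := congrArg Matrix.trace (positivePart_add_negativePart (ρ - σ))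
  rw [Matrix.trace_sub, Matrix.trace_sub, hρ.2, hσ.2, sub_self, sub_eq_zero] at h1
  rw [Matrix.trace_add, ← h1, trace_eq_re (positivePart_posSemidef _)] at h2
  have h3 := congrArg Complex.re h2
  have h4 : (positivePart (ρ - σ)).trace = traceDist ρ σ := by
    rw [trace_eq_re (positivePart_posSemidef _), traceDist, ← h3]
    simp
  exact ⟨h4, h1 ▸ h4⟩

theorem traceDist_nonneg {ρ σ : Matrix a a ℂ} (hρ : IsState ρ) (hσ : IsState σ) :
    0 ≤ traceDist ρ σ := by
  have h := re_trace_nonneg (positivePart_posSemidef (ρ - σ))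
  rwa [(trace_posParts_eq_traceDist hρ hσ).1, Complex.ofReal_re] at h

/-- The Helstrom projection: it separates the parts of `ρ - σ` and attains the trace distance. -/
theorem exists_helstrom_projection {ρ σ : Matrix a a ℂ} (hρ : IsState ρ) (hσ : IsState σ) :
    ∃ Q : Matrix a a ℂ, Q.IsHermitian ∧ Q * Q = Q ∧
      Q * positivePart (ρ - σ) = positivePart (ρ - σ) ∧ Q * negativePart (ρ - σ) = 0 ∧
      (Q * ρ).trace.re - (Q * σ).trace.re = traceDist ρ σ := by
  have hM : (ρ - σ).IsHermitian := hρ.1.isHermitian.sub hσ.1.isHermitian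
  obtain ⟨Q, hQ, hQQ, hQp, hQN⟩ :=
    exists_support_projection (positivePart_posSemidef (ρ - σ)).isHermitian
  have hQn := hQN _ (positivePart_mul_negativePart (ρ - σ))
  refine ⟨Q, hQ, hQQ, hQp, hQn, ?_⟩
  rw [← Complex.sub_re, ← Matrix.trace_sub, ← Matrix.mul_sub,
    ← positivePart_sub_negativePart hM, Matrix.mul_sub, hQp, hQn, sub_zero,
    (trace_posParts_eq_traceDist hρ hσ).1, Complex.ofReal_re]

theorem traceDist_le_one {ρ σ : Matrix a a ℂ} (hρ : IsState ρ) (hσ : IsState σ) :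
    traceDist ρ σ ≤ 1 := by
  obtain ⟨Q, hQ, hQQ, -, -, h⟩ := exists_helstrom_projection hρ hσ
  have h1 := re_trace_projection_mem hρ hQ hQQ
  have h2 := re_trace_projection_mem hσ hQ hQQ
  linarith [h1.2.1, h2.1]

theorem re_trace_posParts_nonneg {Y : Matrix a a ℂ} (hY : Y.IsHermitian) (M : Matrix a a ℂ) :
    0 ≤ (positivePart M * Y * negativePart M * Y).trace.re := by
  have h1 := (negativePart_posSemidef M).conjTranspose_mul_mul_same Y
  rw [hY.eq] at h1
  have := re_trace_mul_nonneg (positivePart_posSemidef M) h1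
  simpa only [Matrix.mul_assoc] using this

/-- The parts of ρ_k - ρ_k', rescaled to trace 1/2 each, are discriminated by the Helstrom
projection. By linearity the error depends on the recovered states only through their difference, so
it is controlled by the two purified distances. Undoing the scaling by 2T produces the factors √T
and T. -/
theorem pair_tradeoff
    {U : Matrix (a' × b') (a × b) ℂ} (hU : Uᴴ * U = 1) (hU' : U * Uᴴ = 1)
    {ρB : Matrix b b ℂ} (hρB : IsState ρB)
    {XA : Matrix a a ℂ} {XB : Matrix b b ℂ} {XA' : Matrix a' a' ℂ} {XB' : Matrix b' b' ℂ}
    (hXA : XA.IsHermitian) (hXB : XB.IsHermitian)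
    (hXA' : XA'.IsHermitian) (hXB' : XB'.IsHermitian)
    {Y : Matrix a a ℂ} (hY : Y = changeOp (channel U ρB) XA XA')
    {ρ : κ → Matrix a a ℂ} (hρ : ∀ k, IsState (ρ k))
    {R : Matrix a' a' ℂ →ₗ[ℂ] Matrix a a ℂ} (hR : IsCPTP R) (k k' : κ) :
    √(positivePart (ρ k - ρ k') * Y * negativePart (ρ k - ρ k') * Y).trace.re
      ≤ √(traceDist (ρ k) (ρ k') * ((purifiedDist (ρ k) (R (channel U ρB (ρ k)))
          + purifiedDist (ρ k') (R (channel U ρB (ρ k')))) / 2))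
          * tradeoffFactor U ρB XA XB XA' XB' ρ
        + spread (violation U XA XB XA' XB') / 2 * traceDist (ρ k) (ρ k') := by
  have hYh : Y.IsHermitian := hY ▸ changeOp_isHermitian U hρB.1.isHermitian hXA hXA'
  set K := tradeoffFactor U ρB XA XB XA' XB' ρ with hK
  have hK0 : 0 ≤ K := tradeoffFactor_nonneg U ρB XA XB XA' XB' ρ
  have hZ0 := spread_nonneg (violation U XA XB XA' XB')
  set T := traceDist (ρ k) (ρ k') with hT
  set D := purifiedDist (ρ k) (R (channel U ρB (ρ k)))
    + purifiedDist (ρ k') (R (channel U ρB (ρ k'))) with hD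
  have hD0 : 0 ≤ D := add_nonneg (purifiedDist_nonneg _ _) (purifiedDist_nonneg _ _)
  have hMh : (ρ k - ρ k').IsHermitian := (hρ k).1.isHermitian.sub (hρ k').1.isHermitian
  obtain ⟨hpT, hnT⟩ := trace_posParts_eq_traceDist (hρ k) (hρ k')
  obtain ⟨Q, hQ, hQQ, hQp, hQn, hQT⟩ := exists_helstrom_projection (hρ k) (hρ k')
  have hT0 : 0 ≤ T := traceDist_nonneg (hρ k) (hρ k')
  have hsub := positivePart_sub_negativePart hMh
  have hposs := positivePart_posSemidef (ρ k - ρ k')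
  have hneg := negativePart_posSemidef (ρ k - ρ k')
  have hrp := range_posParts_le hMh
  set Mp := positivePart (ρ k - ρ k') with hMp
  set Mn := negativePart (ρ k - ρ k') with hMn
  -- The rescaling divides by T; for T = 0 the parts vanish.
  rcases hT0.eq_or_lt with h0 | hTpos
  · have : Mp = 0 := by
      rw [← hposs.trace_eq_zero_iff, hpT, ← hT, ← h0, Complex.ofReal_zero]
    rw [this]
    simp only [Matrix.zero_mul, Matrix.trace_zero, Complex.zero_re, Real.sqrt_zero]
    positivity
  have hrange : LinearMap.range (ρ k - ρ k').mulVecLin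
      ≤ ⨆ k, LinearMap.range (ρ k).mulVecLin := by
    have h1 := range_mulVecLin_add_le (ρ k) ((-1 : ℂ) • ρ k')
    rw [neg_one_smul, ← sub_eq_add_neg] at h1
    have h2 := range_smul_le (-1 : ℂ) (ρ k')
    rw [neg_one_smul] at h2
    exact h1.trans (sup_le (le_iSup (fun k => LinearMap.range (ρ k).mulVecLin) k)
      (h2.trans (le_iSup (fun k => LinearMap.range (ρ k).mulVecLin) k')))
  let Φ : Matrix a a ℂ →ₗ[ℂ] Matrix a a ℂ := R ∘ₗ channel U ρB
  have hΦ : ∀ k, IsState (Φ (ρ k)) := fun k => hR.isState (channel_isState hU hρB (hρ k))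
  have hΦM : (Q * Φ Mp).trace.re - (Q * Φ Mn).trace.re
      = (Q * Φ (ρ k)).trace.re - (Q * Φ (ρ k')).trace.re := by
    rw [← Complex.sub_re, ← Complex.sub_re, ← Matrix.trace_sub, ← Matrix.trace_sub,
      ← Matrix.mul_sub, ← Matrix.mul_sub, ← map_sub, ← map_sub, hsub]
  have hd1 := (abs_le.mp
    (re_trace_projection_sub_le_purifiedDist (hρ k) (hΦ k) hQ hQQ)).2
  have hd2 := (abs_le.mp
    (re_trace_projection_sub_le_purifiedDist (hρ k') (hΦ k') hQ hQQ)).1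
  -- Q distinguishes the original pair by exactly T, and recovery changes each acceptance
  -- probability by at most its purified distance.
  have hd : (Q * Φ Mn).trace.re + (T - (Q * Φ Mp).trace.re) ≤ D := by
    change _ ≤ purifiedDist (ρ k) (Φ (ρ k)) + purifiedDist (ρ k') (Φ (ρ k'))
    linarith
  set r : ℝ := (2 * T)⁻¹ with hr
  have hr0 : 0 ≤ r := by positivity
  have hrT : r * T = 1 / 2 := by rw [hr]; field_simp
  have hscale : ∀ M, (Q * Φ ((r : ℂ) • M)).trace.re = r * (Q * Φ M).trace.re := fun M => by
    rw [map_smul, Matrix.mul_smul, Matrix.trace_smul, smul_eq_mul, Complex.re_ofReal_mul]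
  have hαtr : ((r : ℂ) • Mp).trace = ((1 / 2 : ℝ) : ℂ) := by
    rw [Matrix.trace_smul, hpT, smul_eq_mul, ← Complex.ofReal_mul, ← hT, hrT]
  have hβtr : ((r : ℂ) • Mn).trace = ((1 / 2 : ℝ) : ℂ) := by
    rw [Matrix.trace_smul, hnT, smul_eq_mul, ← Complex.ofReal_mul, ← hT, hrT]
  have main := discrimination_tradeoff hU' hρB hXA hXB hXA' hXB' hY hYh ρ
    (posSemidef_ofReal_smul hr0 hposs) (posSemidef_ofReal_smul hr0 hneg)
    (by rw [hαtr, hβtr, ← Complex.ofReal_add]; norm_num) hQ hQQ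
    (by rw [Matrix.mul_smul, hQp]) (by rw [Matrix.mul_smul, hQn, smul_zero])
    ((range_smul_le _ _).trans (hrp.1.trans hrange))
    ((range_smul_le _ _).trans (hrp.2.trans hrange)) hR (Real.sqrt_nonneg (r * D)) (by
      rw [Real.sq_sqrt (by positivity), hαtr, Complex.ofReal_re, ← hrT]
      change (Q * Φ ((r : ℂ) • Mn)).trace.re + (r * T - (Q * Φ ((r : ℂ) • Mp)).trace.re) ≤ r * D
      rw [hscale, hscale, ← mul_sub, ← mul_add]
      exact mul_le_mul_of_nonneg_left hd hr0)
  have hc : ((r : ℂ) • Mp * Y * (r : ℂ) • Mn * Y).trace.re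
      = r ^ 2 * (Mp * Y * Mn * Y).trace.re := by
    simp only [Matrix.smul_mul, Matrix.mul_smul, Matrix.trace_smul, smul_eq_mul,
      Complex.re_ofReal_mul]
    ring
  rw [hc, Real.sqrt_mul (sq_nonneg r), Real.sqrt_sq hr0] at main
  have hhalf : √(((r : ℂ) • Mp).trace.re * (1 - ((r : ℂ) • Mp).trace.re)) ≤ 1 / 2 :=
    sqrt_mul_one_sub_le_half
  have main' := mul_le_mul_of_nonneg_left
    (main.trans (add_le_add_right (mul_le_mul_of_nonneg_left hhalf hZ0) _)) hT0
  have e1 : T * (2 * (r * √(Mp * Y * Mn * Y).trace.re)) = √(Mp * Y * Mn * Y).trace.re := by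
    linear_combination 2 * √(Mp * Y * Mn * Y).trace.re * hrT
  have e2 : T * √(r * D) = √(T * (D / 2)) := by
    have : T * (D / 2) = T ^ 2 * (r * D) := by linear_combination (-(T * D)) * hrT
    rw [this, Real.sqrt_mul (sq_nonneg T), Real.sqrt_sq hT0]
  rw [e1, mul_add, ← mul_assoc, e2] at main'
  linarith

/-- The diagonal terms vanish because the positive part of 0 is 0. -/
theorem offDiag_eq_sqrt_sum_prod (p : κ → ℝ) (ρ : κ → Matrix a a ℂ) (Y : Matrix a a ℂ) :
    offDiag p ρ Y = √(∑ x : κ × κ, p x.1 * p x.2 *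
      (positivePart (ρ x.1 - ρ x.2) * Y * negativePart (ρ x.1 - ρ x.2) * Y).trace.re) := by
  rw [offDiag, Fintype.sum_prod_type]
  congr 1
  refine Finset.sum_congr rfl fun k _ => ?_
  rw [sum_filter_ne_eq_sub]
  have h := (posParts_unique (Matrix.PosSemidef.zero (n := a) (R := ℂ)) Matrix.PosSemidef.zero
    (Matrix.mul_zero _)).1
  rw [sub_zero] at h
  simp [h]

/-- Minkowski's inequality in the weights p_k p_k' separates the error term from the violation term.
-/
theorem offDiag_le
    {U : Matrix (a' × b') (a × b) ℂ} (hU : Uᴴ * U = 1) (hU' : U * Uᴴ = 1)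
    {ρB : Matrix b b ℂ} (hρB : IsState ρB)
    {XA : Matrix a a ℂ} {XB : Matrix b b ℂ} {XA' : Matrix a' a' ℂ} {XB' : Matrix b' b' ℂ}
    (hXA : XA.IsHermitian) (hXB : XB.IsHermitian)
    (hXA' : XA'.IsHermitian) (hXB' : XB'.IsHermitian)
    {Y : Matrix a a ℂ} (hY : Y = changeOp (channel U ρB) XA XA')
    {p : κ → ℝ} {ρ : κ → Matrix a a ℂ} (hp : ∀ k, 0 ≤ p k) (hp1 : ∑ k, p k = 1)
    (hρ : ∀ k, IsState (ρ k))
    {R : Matrix a' a' ℂ →ₗ[ℂ] Matrix a a ℂ} (hR : IsCPTP R) :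
    offDiag p ρ Y ≤ √(recoveryError (channel U ρB) p ρ R) * √(meanTraceDist p ρ)
        * tradeoffFactor U ρB XA XB XA' XB' ρ
        + spread (violation U XA XB XA' XB') / 2 * meanTraceDist p ρ := by
  have hYh : Y.IsHermitian := hY ▸ changeOp_isHermitian U hρB.1.isHermitian hXA hXA'
  have hZ0 := spread_nonneg (violation U XA XB XA' XB')
  set Z := violation U XA XB XA' XB'
  set K := tradeoffFactor U ρB XA XB XA' XB' ρ with hK
  have hK0 : 0 ≤ K := tradeoffFactor_nonneg U ρB XA XB XA' XB' ρ
  let w : κ × κ → ℝ := fun x => p x.1 * p x.2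
  have hw : ∀ x, 0 ≤ w x := fun x => mul_nonneg (hp _) (hp _)
  let c : κ × κ → ℝ := fun x =>
    (positivePart (ρ x.1 - ρ x.2) * Y * negativePart (ρ x.1 - ρ x.2) * Y).trace.re
  have hc0 : ∀ x, 0 ≤ c x := fun x => re_trace_posParts_nonneg hYh _
  let T : κ × κ → ℝ := fun x => traceDist (ρ x.1) (ρ x.2)
  have hT0 : ∀ x, 0 ≤ T x := fun x => traceDist_nonneg (hρ _) (hρ _)
  let d : κ → ℝ := fun k => purifiedDist (ρ k) (R (channel U ρB (ρ k)))
  have hd0 : ∀ k, 0 ≤ d k := fun k => purifiedDist_nonneg _ _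
  let D : κ × κ → ℝ := fun x => (d x.1 + d x.2) / 2
  have hD0 : ∀ x, 0 ≤ D x := fun x => by
    have h1 := hd0 x.1
    have h2 := hd0 x.2
    simp only [D]
    positivity
  have hpair : ∀ x, √(c x) ≤ √(T x * D x) * K + spread Z / 2 * T x := fun x =>
    pair_tradeoff hU hU' hρB hXA hXB hXA' hXB' hY hρ hR x.1 x.2
  have hmean : meanTraceDist p ρ = √(∑ x, w x * T x ^ 2) := by
    rw [meanTraceDist, Fintype.sum_prod_type]
  -- Cauchy–Schwarz separates T from D. By convexity D² is at most the mean of the two squared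
  -- purified distances, whose weighted average is the squared recovery error.
  have hTD : √(∑ x, w x * (T x * D x))
      ≤ √(recoveryError (channel U ρB) p ρ R) * √(meanTraceDist p ρ) := by
    rw [mul_comm, ← Real.sqrt_mul (show 0 ≤ meanTraceDist p ρ from Real.sqrt_nonneg _)]
    refine Real.sqrt_le_sqrt ?_
    have h1 := Real.sum_mul_le_sqrt_mul_sqrt Finset.univ (fun x => √(w x) * T x)
      (fun x => √(w x) * D x)
    have h2 : ∀ x, √(w x) * T x * (√(w x) * D x) = w x * (T x * D x) := fun x => by
      linear_combination (T x * D x) * Real.mul_self_sqrt (hw x)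
    have h3 : ∀ (f : κ × κ → ℝ) x, (√(w x) * f x) ^ 2 = w x * f x ^ 2 := fun f x => by
      rw [mul_pow, Real.sq_sqrt (hw x)]
    simp only [h2, h3] at h1
    rw [← hmean] at h1
    refine h1.trans (mul_le_mul_of_nonneg_left (Real.sqrt_le_sqrt ?_) (Real.sqrt_nonneg _))
    have h4 : ∀ x : κ × κ, w x * D x ^ 2
        ≤ p x.1 * (p x.2 * d x.2 ^ 2) / 2 + p x.1 * d x.1 ^ 2 * p x.2 / 2 := fun x => by
      have h5 : D x ^ 2 ≤ (d x.1 ^ 2 + d x.2 ^ 2) / 2 := by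
        simp only [D]
        nlinarith [sq_nonneg (d x.1 - d x.2)]
      have := mul_le_mul_of_nonneg_left h5 (hw x)
      simp only [w] at this ⊢
      linarith
    refine (Finset.sum_le_sum fun x _ => h4 x).trans (le_of_eq ?_)
    rw [Finset.sum_add_distrib, ← Finset.sum_div, ← Finset.sum_div, Fintype.sum_prod_type,
      Fintype.sum_prod_type]
    simp only [← Finset.mul_sum, ← Finset.sum_mul, hp1]
    simp only [d]
    ring
  calc offDiag p ρ Y = √(∑ x, (√(w x) * √(c x)) ^ 2) := by
        rw [offDiag_eq_sqrt_sum_prod]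
        congr 1
        refine Finset.sum_congr rfl fun x _ => ?_
        rw [mul_pow, Real.sq_sqrt (hw x), Real.sq_sqrt (hc0 x)]
    _ ≤ √(∑ x, (√(w x) * (√(T x * D x) * K) + √(w x) * (spread Z / 2 * T x)) ^ 2) := by
        refine Real.sqrt_le_sqrt (Finset.sum_le_sum fun x _ => ?_)
        rw [← mul_add]
        exact pow_le_pow_left₀ (by positivity)
          (mul_le_mul_of_nonneg_left (hpair x) (Real.sqrt_nonneg _)) 2
    _ ≤ √(∑ x, (√(w x) * (√(T x * D x) * K)) ^ 2)
        + √(∑ x, (√(w x) * (spread Z / 2 * T x)) ^ 2) := sqrt_sum_sq_add_le _ _ _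
    _ = √(∑ x, w x * (T x * D x)) * K + spread Z / 2 * meanTraceDist p ρ := by
        have h1 : ∑ x, (√(w x) * (√(T x * D x) * K)) ^ 2
            = (∑ x, w x * (T x * D x)) * K ^ 2 := by
          rw [Finset.sum_mul]
          refine Finset.sum_congr rfl fun x _ => ?_
          rw [mul_pow, mul_pow, Real.sq_sqrt (hw x),
            Real.sq_sqrt (mul_nonneg (hT0 x) (hD0 x)), ← mul_assoc]
        have h2 : ∑ x, (√(w x) * (spread Z / 2 * T x)) ^ 2
            = (spread Z / 2) ^ 2 * ∑ x, w x * T x ^ 2 := by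
          rw [Finset.mul_sum]
          refine Finset.sum_congr rfl fun x _ => ?_
          rw [mul_pow, mul_pow, Real.sq_sqrt (hw x)]
          ring
        rw [h1, h2, Real.sqrt_mul' _ (sq_nonneg K), Real.sqrt_sq hK0,
          Real.sqrt_mul (sq_nonneg _), Real.sqrt_sq (by positivity), hmean]
    _ ≤ _ := by gcongr

theorem meanTraceDist_le_one {p : κ → ℝ} {ρ : κ → Matrix a a ℂ} (hp : ∀ k, 0 ≤ p k)
    (hp1 : ∑ k, p k = 1) (hρ : ∀ k, IsState (ρ k)) : meanTraceDist p ρ ≤ 1 := by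
  refine Real.sqrt_le_one.mpr ?_
  have h : ∀ k k', p k * p k' * traceDist (ρ k) (ρ k') ^ 2 ≤ p k * p k' := fun k k' =>
    mul_le_of_le_one_right (mul_nonneg (hp k) (hp k'))
      (pow_le_one₀ (traceDist_nonneg (hρ k) (hρ k')) (traceDist_le_one (hρ k) (hρ k')))
  refine (Finset.sum_le_sum fun k _ => Finset.sum_le_sum fun k' _ => h k k').trans ?_
  simp only [← Finset.mul_sum, hp1, mul_one, le_refl]

end GeneralEnsembles

/-! ### Passing to the infimum over recovery maps. -/

section Infimum

theorem le_csInf_mul {S : Set ℝ} (hS : S.Nonempty) {x c : ℝ} (hc : 0 ≤ c)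
    (h : ∀ e ∈ S, x ≤ e * c) : x ≤ sInf S * c := by
  rcases hc.eq_or_lt with rfl | hc
  · obtain ⟨e, he⟩ := hS
    simpa using h e he
  · rw [← div_le_iff₀ hc]
    exact le_csInf hS fun e he => (div_le_iff₀ hc).mpr (h e he)

/-- Squaring reduces the root to the linear case, so neither continuity nor attainment of the
infimum is needed. -/
theorem le_sqrt_csInf_mul {S : Set ℝ} (hS : S.Nonempty) (hS0 : ∀ e ∈ S, 0 ≤ e) {x c : ℝ}
    (hc : 0 ≤ c) (h : ∀ e ∈ S, x ≤ √e * c) : x ≤ √(sInf S) * c := by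
  rcases le_total x 0 with hx | hx
  · exact hx.trans (by positivity)
  have h1 : x ^ 2 ≤ sInf S * c ^ 2 := le_csInf_mul hS (sq_nonneg c) fun e he => by
    have := pow_le_pow_left₀ hx (h e he) 2
    rwa [mul_pow, Real.sq_sqrt (hS0 e he)] at this
  rw [← Real.sqrt_sq hc, ← Real.sqrt_mul (Real.sInf_nonneg hS0)]
  exact Real.le_sqrt_of_sq_le h1

end Infimum

end

end QuantumTradeoff

/-! ### Assembly of the three trade-offs. -/

theorem mainTheorem3
    {a b a' b' : Type*} [Fintype a] [DecidableEq a] [Fintype b] [DecidableEq b]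
    [Fintype a'] [DecidableEq a'] [Fintype b'] [DecidableEq b']
    (U : Matrix (a' × b') (a × b) ℂ) (hU : Uᴴ * U = 1) (hU' : U * Uᴴ = 1)
    (ρB : Matrix b b ℂ) (hρB : IsState ρB)
    (XA : Matrix a a ℂ) (XB : Matrix b b ℂ) (XA' : Matrix a' a' ℂ) (XB' : Matrix b' b' ℂ)
    (hXA : XA.IsHermitian) (hXB : XB.IsHermitian)
    (hXA' : XA'.IsHermitian) (hXB' : XB'.IsHermitian)
    (Z : Matrix (a × b) (a × b) ℂ) (hZ : Z = violation U XA XB XA' XB')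
    (Y : Matrix a a ℂ) (hY : Y = changeOp (channel U ρB) XA XA') :
    -- coherence cost of operator conversion
    (∀ (ρ Q : Matrix a a ℂ) (P : Matrix a' a' ℂ) (ε : ℝ),
      IsState ρ → Q.IsHermitian → Q * Q = Q → P.PosSemidef → (1 - P).PosSemidef → 0 ≤ ε →
      (dualMap (channel U ρB) P * ((1 - Q) * ρ * (1 - Q))).trace.re
        + ((1 - dualMap (channel U ρB) P) * (Q * ρ * Q)).trace.re ≤ ε ^ 2 →
      ‖((Q * Y - Y * Q) * ρ).trace‖ - spread Z / 2
        ≤ ε * (stateDelta U ρB XA XA' ρ + spread Z + √(qfi ρB XB))) ∧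
    -- trade-offs for test ensembles
    (∀ {κ : Type*} [Fintype κ] [DecidableEq κ] (p : κ → ℝ) (ρ : κ → Matrix a a ℂ),
      (∀ k, 0 ≤ p k) → ∑ k, p k = 1 → (∀ k, IsState (ρ k)) →
      -- orthogonal test states
      ((∀ k k', k ≠ k' → fidelity (ρ k) (ρ k') = 0) →
        offDiag p ρ Y - spread Z / 2
          ≤ (irreversibility (channel U ρB) p ρ * √(1 - ⨅ k, p k))
            * (ensembleDelta U ρB XA XA' ρ + spread Z + √(qfi ρB XB)) ∧
        irreversibility (channel U ρB) p ρ * √(1 - ⨅ k, p k)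
          ≤ irreversibility (channel U ρB) p ρ) ∧
      -- arbitrary test states
      (offDiag p ρ Y - spread Z / 2
          ≤ (√(irreversibility (channel U ρB) p ρ) * √(meanTraceDist p ρ))
            * (ensembleDelta U ρB XA XA' ρ + spread Z + √(qfi ρB XB)) ∧
        √(irreversibility (channel U ρB) p ρ) * √(meanTraceDist p ρ)
          ≤ √(irreversibility (channel U ρB) p ρ))) := by
  subst hZ hY
  refine ⟨fun ρ Q P ε hρ hQ hQQ hP hP' hε h => ?_, fun {κ} _ _ p ρ hp hp1 hρ => ?_⟩
  · have main := operator_conversion hU' hρB hXA hXB hXA' hXB' hρ hQ hQQ hP hP' hε h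
    have h1 : spread (violation U XA XB XA' XB') * √((Q * ρ).trace.re * (1 - (Q * ρ).trace.re))
        ≤ spread (violation U XA XB XA' XB') * (1 / 2) :=
      mul_le_mul_of_nonneg_left sqrt_mul_one_sub_le_half (spread_nonneg _)
    linarith
  have hne : Nonempty κ := by
    by_contra hκ
    rw [not_nonempty_iff] at hκ
    simp at hp1
  obtain ⟨k₀⟩ := hne
  have hZ0 := spread_nonneg (violation U XA XB XA' XB')
  have hK0 := tradeoffFactor_nonneg U ρB XA XB XA' XB' ρ
  have hinf : 0 ≤ ⨅ k, p k := Real.iInf_nonneg hp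
  have hset : {e : ℝ | ∃ R : Matrix a' a' ℂ →ₗ[ℂ] Matrix a a ℂ, IsCPTP R ∧
      e = recoveryError (channel U ρB) p ρ R}.Nonempty := by
    obtain ⟨R, hR⟩ := exists_isCPTP (a := a') (hρ k₀)
    exact ⟨_, R, hR, rfl⟩
  have hset0 : ∀ e ∈ {e : ℝ | ∃ R : Matrix a' a' ℂ →ₗ[ℂ] Matrix a a ℂ, IsCPTP R ∧
      e = recoveryError (channel U ρB) p ρ R}, 0 ≤ e := by
    rintro _ ⟨R, -, rfl⟩
    exact Real.sqrt_nonneg _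
  have hirr : 0 ≤ irreversibility (channel U ρB) p ρ := Real.sInf_nonneg hset0
  have hmean := meanTraceDist_le_one hp hp1 hρ
  have hmean0 : 0 ≤ meanTraceDist p ρ := Real.sqrt_nonneg _
  refine ⟨fun hF => ⟨?_, ?_⟩, ?_, ?_⟩
  · rw [mul_assoc]
    refine le_csInf_mul hset (mul_nonneg (Real.sqrt_nonneg _) hK0) ?_
    rintro _ ⟨R, hR, rfl⟩
    have hrec : 0 ≤ recoveryError (channel U ρB) p ρ R := Real.sqrt_nonneg _
    -- With a single test state the minimal weight is 1 and the comparison with √2 fails, but there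
    -- are no pairs and the off-diagonal strength is 0.
    by_cases hsub : Subsingleton κ
    · have h0 : offDiag p ρ (changeOp (channel U ρB) XA XA') = 0 := by
        rw [offDiag, Real.sqrt_eq_zero']
        refine (Finset.sum_eq_zero fun k _ => Finset.sum_eq_zero fun k' hk' => ?_).le
        exact absurd (Subsingleton.elim k' k) (Finset.mem_filter.mp hk').2
      rw [h0]
      have : 0 ≤ recoveryError (channel U ρB) p ρ R * (√(1 - ⨅ k, p k)
          * tradeoffFactor U ρB XA XB XA' XB' ρ) := by positivity
      unfold tradeoffFactor at this
      linarith
    · obtain ⟨k, k', hkk⟩ := not_subsingleton_iff_nontrivial.mp hsub |>.exists_pair_ne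
      have h1 := offDiag_le_of_orthogonal hU hU' hρB hXA hXB hXA' hXB' rfl hp hp1 hρ
        (fun k k' h => mul_eq_zero_of_fidelity_eq_zero (hρ k).1 (hρ k').1 (hF k k' h)) hR
      have h2 := mul_le_mul_of_nonneg_right (sqrt_two_le_of_ne hp hp1 hkk) (mul_nonneg hrec hK0)
      unfold tradeoffFactor at h1 h2
      linarith
  · exact mul_le_of_le_one_right hirr (Real.sqrt_le_one.mpr (by linarith))
  · rw [mul_assoc]
    refine le_sqrt_csInf_mul hset hset0 (mul_nonneg (Real.sqrt_nonneg _) hK0) ?_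
    rintro _ ⟨R, hR, rfl⟩
    have h1 := offDiag_le hU hU' hρB hXA hXB hXA' hXB' rfl hp hp1 hρ hR
    have h2 := mul_le_mul_of_nonneg_left hmean (div_nonneg hZ0 zero_le_two)
    unfold tradeoffFactor at h1
    linarith
  · exact mul_le_of_le_one_right (Real.sqrt_nonneg _) (Real.sqrt_le_one.mpr hmean)
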